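/- Let $r,s\in\mathbb{C}^{*}$ be such that $r^{m}s^{n}=1$ with $m,n\in\mathbb{Z}$ implies $m=n=0$. Let $\check U=\check{U}_{r,s}^{\geq 0}(G_2)$ be the associative unital $\mathbb{C}$-algebra generated by $e_1,e_2,k_1^{\pm1},k_2^{\pm1}$ subject to the relations $$k_1k_1^{-1}=k_1^{-1}k_1=1,\qquad k_2k_2^{-1}=k_2^{-1}k_2=1,\qquad k_1k_2=k_2k_1,$$ $$k_1e_1=r^{-1}s^{-2}e_1k_1,\quad k_1e_2=r^{3}s^{3}e_2k_1,\quad k_2e_1=r^{-3}s^{-3}e_1k_2,\quad k_2e_2=r^{6}s^{3}e_2k_2,$$ $$e_2^2e_1-(r^{-3}+s^{-3})e_2e_1e_2+r^{-3}s^{-3}e_1e_2^2=0,$$ $$e_1^4e_2-(r+s)(r^2+s^2)e_1^3e_2e_1+rs(r^2+s^2)(r^2+rs+s^2)e_1^2e_2e_1^2-r^3s^3(r+s)(r^2+s^2)e_1e_2e_1^3+r^6s^6e_2e_1^4=0,$$ with the Hopf algebra structure determined by $$\Delta(e_1)=e_1\otimes 1+k_1^{2}k_2^{-1}\otimes e_1,\quad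 \Delta(e_2)=e_2\otimes 1+k_1^{-3}k_2^{2}\otimes e_2,\quad \Delta(k_l)=k_l\otimes k_l,$$ $$\varepsilon(e_l)=0,\quad \varepsilon(k_l)=1,\quad S(e_1)=-(k_1^{2}k_2^{-1})^{-1}e_1,\quad S(e_2)=-(k_1^{-3}k_2^{2})^{-1}e_2,\quad S(k_l)=k_l^{-1}\qquad(l=1,2).$$ Let $\mathrm{Aut}_{\mathrm{Hopf}}(\check U)$ be the group of $\mathbb{C}$-algebra automorphisms of $\check U$ that commute with comultiplication, counit and antipode. Then every $\theta\in \mathrm{Aut}_{\mathrm{Hopf}}(\check U)$ satisfies $$\theta(k_l)=k_l,\qquad \theta(e_l)=\gamma_le_l\qquad(l=1,2)$$ for some $\gamma_1,\gamma_2\in\mathbb{C}^{*}$. Moreover $\theta\mapsto(\gamma_1,\gamma_2)$ is a group isomorphism $\mathrm{Aut}_{\mathrm{Hopf}}(\check U)\cong(\mathbb{C}^{*})^{2}$. -/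

import Mathlib

open scoped TensorProduct

noncomputable section

/-- The generators `e₁, e₂, k₁, k₂, k₁⁻¹, k₂⁻¹`. -/
inductive BorelG2Gen : Type
  | e₁ | e₂ | k₁ | k₂ | k₁inv | k₂inv

/-- The left-hand side `x⁴y - (r+s)(r²+s²)x³yx + rs(r²+s²)(r²+rs+s²)x²yx²
  - r³s³(r+s)(r²+s²)xyx³ + r⁶s⁶yx⁴` of the quartic two-parameter quantum Serre relation. -/
def serreQuartic {B : Type*} [Ring B] [Algebra ℂ B] (r s : ℂˣ) (x y : B) : B :=
  x ^ 4 * y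
    - (((r : ℂ) + s) * ((r : ℂ) ^ 2 + (s : ℂ) ^ 2)) • (x ^ 3 * y * x)
    + ((r : ℂ) * s * ((r : ℂ) ^ 2 + (s : ℂ) ^ 2) * ((r : ℂ) ^ 2 + r * s + (s : ℂ) ^ 2)) •
        (x ^ 2 * y * x ^ 2)
    - ((r : ℂ) ^ 3 * (s : ℂ) ^ 3 * ((r : ℂ) + s) * ((r : ℂ) ^ 2 + (s : ℂ) ^ 2)) • (x * y * x ^ 3)
    + ((r : ℂ) ^ 6 * (s : ℂ) ^ 6) • (y * x ^ 4)

/-- The left-hand side `y²x - (r⁻³+s⁻³)yxy + r⁻³s⁻³xy²` of the quadratic two-parameter quantum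
Serre relation. -/
def serreQuadratic {B : Type*} [Ring B] [Algebra ℂ B] (r s : ℂˣ) (x y : B) : B :=
  y ^ 2 * x
    - ((r : ℂ)⁻¹ ^ 3 + (s : ℂ)⁻¹ ^ 3) • (y * x * y)
    + ((r : ℂ)⁻¹ ^ 3 * (s : ℂ)⁻¹ ^ 3) • (x * y ^ 2)

open BorelG2Gen FreeAlgebra in
/-- The defining relations of the augmented two-parameter quantum Borel algebra of type `G₂`. -/
inductive BorelG2Rel (r s : ℂˣ) : FreeAlgebra ℂ BorelG2Gen → FreeAlgebra ℂ BorelG2Gen → Prop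
  | k₁_mul_inv : BorelG2Rel r s (ι ℂ k₁ * ι ℂ k₁inv) 1
  | k₁_inv_mul : BorelG2Rel r s (ι ℂ k₁inv * ι ℂ k₁) 1
  | k₂_mul_inv : BorelG2Rel r s (ι ℂ k₂ * ι ℂ k₂inv) 1
  | k₂_inv_mul : BorelG2Rel r s (ι ℂ k₂inv * ι ℂ k₂) 1
  | k₁_k₂ : BorelG2Rel r s (ι ℂ k₁ * ι ℂ k₂) (ι ℂ k₂ * ι ℂ k₁)
  | k₁_e₁ : BorelG2Rel r s (ι ℂ k₁ * ι ℂ e₁) (((r : ℂ)⁻¹ * (s : ℂ)⁻¹ ^ 2) • (ι ℂ e₁ * ι ℂ k₁))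
  | k₁_e₂ : BorelG2Rel r s (ι ℂ k₁ * ι ℂ e₂) (((r : ℂ) ^ 3 * (s : ℂ) ^ 3) • (ι ℂ e₂ * ι ℂ k₁))
  | k₂_e₁ : BorelG2Rel r s (ι ℂ k₂ * ι ℂ e₁)
      (((r : ℂ)⁻¹ ^ 3 * (s : ℂ)⁻¹ ^ 3) • (ι ℂ e₁ * ι ℂ k₂))
  | k₂_e₂ : BorelG2Rel r s (ι ℂ k₂ * ι ℂ e₂) (((r : ℂ) ^ 6 * (s : ℂ) ^ 3) • (ι ℂ e₂ * ι ℂ k₂))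
  | serre₂ : BorelG2Rel r s (serreQuadratic r s (ι ℂ e₁) (ι ℂ e₂)) 0
  | serre₄ : BorelG2Rel r s (serreQuartic r s (ι ℂ e₁) (ι ℂ e₂)) 0

/-- The augmented two-parameter quantum Borel algebra `Ǔ_{r,s}^{≥0}(G₂)`, as the `ℂ`-algebra given
by generators and relations. -/
def BorelG2 (r s : ℂˣ) : Type := RingQuot (BorelG2Rel r s)

/-- The relations of `BorelG2 r s`, for elements of an arbitrary `ℂ`-algebra. -/
structure BorelG2Sat {B : Type*} [Ring B] [Algebra ℂ B] (r s : ℂˣ) (e₁ e₂ : B) (k₁ k₂ : Bˣ) :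
    Prop where
  k₁_k₂ : (k₁ : B) * k₂ = k₂ * k₁
  k₁_e₁ : k₁ * e₁ = ((r : ℂ)⁻¹ * (s : ℂ)⁻¹ ^ 2) • (e₁ * k₁)
  k₁_e₂ : k₁ * e₂ = ((r : ℂ) ^ 3 * (s : ℂ) ^ 3) • (e₂ * k₁)
  k₂_e₁ : k₂ * e₁ = ((r : ℂ)⁻¹ ^ 3 * (s : ℂ)⁻¹ ^ 3) • (e₁ * k₂)
  k₂_e₂ : k₂ * e₂ = ((r : ℂ) ^ 6 * (s : ℂ) ^ 3) • (e₂ * k₂)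
  serre₂ : serreQuadratic r s e₁ e₂ = 0
  serre₄ : serreQuartic r s e₁ e₂ = 0

section Serre

variable {B C : Type*} [Ring B] [Algebra ℂ B] [Ring C] [Algebra ℂ C]

theorem map_serreQuartic (f : B →ₐ[ℂ] C) (r s : ℂˣ) (x y : B) :
    f (serreQuartic r s x y) = serreQuartic r s (f x) (f y) := by
  simp [serreQuartic]

theorem map_serreQuadratic (f : B →ₐ[ℂ] C) (r s : ℂˣ) (x y : B) :
    f (serreQuadratic r s x y) = serreQuadratic r s (f x) (f y) := by
  simp [serreQuadratic]

theorem mul_mul_of_qcomm {x y : B} {q : ℂ} (h : x * y = q • (y * x)) (z : B) :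
    x * (y * z) = q • (y * (x * z)) := by
  rw [← mul_assoc, h, smul_mul_assoc, mul_assoc]

theorem serreQuadratic_add (r s : ℂˣ) {a b c d : B}
    (hdc : d * c = ((r : ℂ) ^ 3 * (s : ℂ)⁻¹ ^ 3) • (c * d))
    (hbc : b * c = ((s : ℂ) ^ 3) • (c * b)) (hda : d * a = ((r : ℂ)⁻¹ ^ 3) • (a * d)) :
    serreQuadratic r s (a + b) (c + d) = serreQuadratic r s a c + serreQuadratic r s b d := by
  have hr : (r : ℂ) ≠ 0 := r.ne_zero
  have hs : (s : ℂ) ≠ 0 := s.ne_zero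
  simp only [serreQuadratic, pow_succ, pow_zero, one_mul, mul_add, add_mul, mul_assoc, hdc, hbc,
    hda, mul_mul_of_qcomm hdc, mul_mul_of_qcomm hbc, mul_mul_of_qcomm hda, mul_smul_comm,
    smul_mul_assoc, smul_add, smul_smul]
  match_scalars <;> field_simp <;> ring

set_option maxHeartbeats 1000000 in
theorem serreQuartic_add (r s : ℂˣ) {a b c d : B}
    (hba : b * a = ((r : ℂ) * (s : ℂ)⁻¹) • (a * b))
    (hbc : b * c = ((s : ℂ) ^ 3) • (c * b)) (hda : d * a = ((r : ℂ)⁻¹ ^ 3) • (a * d)) :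
    serreQuartic r s (a + b) (c + d) = serreQuartic r s a c + serreQuartic r s b d := by
  have hr : (r : ℂ) ≠ 0 := r.ne_zero
  have hs : (s : ℂ) ≠ 0 := s.ne_zero
  simp only [serreQuartic, pow_succ, pow_zero, one_mul, mul_add, add_mul, mul_assoc, hba, hbc,
    hda, mul_mul_of_qcomm hba, mul_mul_of_qcomm hbc, mul_mul_of_qcomm hda, mul_smul_comm,
    smul_mul_assoc, smul_add, smul_smul]
  match_scalars <;> field_simp <;> ring

open MulOpposite in
theorem serreQuadratic_op (r s : ℂˣ) {u v e f : B}
    (huv : v * u = u * v)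
    (hev : e * v = ((r : ℂ)⁻¹ ^ 3) • (v * e))
    (hfu : f * u = ((s : ℂ) ^ 3) • (u * f))
    (hfv : f * v = ((r : ℂ) ^ 3 * (s : ℂ)⁻¹ ^ 3) • (v * f)) :
    serreQuadratic r s (op (-(u * e))) (op (-(v * f))) =
      op (-(u * v ^ 2 * serreQuadratic r s e f)) := by
  have hr : (r : ℂ) ≠ 0 := r.ne_zero
  have hs : (s : ℂ) ≠ 0 := s.ne_zero
  have huv' : v * u = (1 : ℂ) • (u * v) := by rw [one_smul, huv]
  apply unop_injective
  simp only [serreQuadratic, pow_succ, pow_zero, one_mul, unop_add, unop_sub, unop_smul, unop_mul,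
    unop_op, mul_add, mul_sub, mul_assoc, neg_mul, mul_neg,
    mul_mul_of_qcomm huv', mul_mul_of_qcomm hev, mul_mul_of_qcomm hfu,
    mul_mul_of_qcomm hfv, mul_smul_comm, smul_mul_assoc, smul_neg, neg_neg, smul_smul]
  match_scalars <;> field_simp

open MulOpposite in
set_option maxHeartbeats 1000000 in
theorem serreQuartic_op (r s : ℂˣ) {u v e f : B}
    (huv : v * u = u * v)
    (heu : e * u = ((r : ℂ) * (s : ℂ)⁻¹) • (u * e)) (hev : e * v = ((r : ℂ)⁻¹ ^ 3) • (v * e))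
    (hfu : f * u = ((s : ℂ) ^ 3) • (u * f)) :
    serreQuartic r s (op (-(u * e))) (op (-(v * f))) =
      op (-(u ^ 4 * v * serreQuartic r s e f)) := by
  have hr : (r : ℂ) ≠ 0 := r.ne_zero
  have hs : (s : ℂ) ≠ 0 := s.ne_zero
  have huv' : v * u = (1 : ℂ) • (u * v) := by rw [one_smul, huv]
  apply unop_injective
  simp only [serreQuartic, pow_succ, pow_zero, one_mul, unop_add, unop_sub, unop_smul, unop_mul,
    unop_op, mul_add, mul_sub, mul_assoc, neg_mul, mul_neg,
    mul_mul_of_qcomm huv', mul_mul_of_qcomm heu, mul_mul_of_qcomm hev, mul_mul_of_qcomm hfu,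
    mul_smul_comm, smul_mul_assoc, smul_neg, neg_neg, smul_smul]
  match_scalars <;> field_simp

end Serre

section QCommutation

variable {B : Type*} [Ring B] [Algebra ℂ B]

theorem qcomm_inv {k : Bˣ} {x : B} {q : ℂ} (hq : q ≠ 0) (h : k * x = q • (x * k)) :
    (k⁻¹ : Bˣ) * x = q⁻¹ • (x * (k⁻¹ : Bˣ)) := by
  have h1 : x * (k⁻¹ : Bˣ) = q • ((k⁻¹ : Bˣ) * x) := by
    rw [← Units.mul_right_inj k, ← mul_assoc, h, mul_smul_comm, smul_mul_assoc, mul_assoc,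
      Units.mul_inv, mul_one, Units.mul_inv_cancel_left]
  rw [h1, smul_smul, inv_mul_cancel₀ hq, one_smul]

theorem qcomm_mul {k l x : B} {p q : ℂ} (hk : k * x = p • (x * k)) (hl : l * x = q • (x * l)) :
    k * l * x = (p * q) • (x * (k * l)) := by
  rw [mul_assoc, hl, mul_smul_comm, ← mul_assoc, hk, smul_mul_assoc, smul_smul, mul_assoc,
    mul_comm q]

theorem qcomm_pow {k x : B} {p : ℂ} (hk : k * x = p • (x * k)) (n : ℕ) :
    k ^ n * x = p ^ n • (x * k ^ n) := by
  induction n with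
  | zero => simp
  | succ n ih => rw [pow_succ, qcomm_mul ih hk, pow_succ]

end QCommutation

/-- The element `k₁²k₂⁻¹`. -/
def wUnit₁ {B : Type*} [Monoid B] (k₁ k₂ : Bˣ) : Bˣ := k₁ ^ 2 * k₂⁻¹

/-- The element `k₁⁻³k₂²`. -/
def wUnit₂ {B : Type*} [Monoid B] (k₁ k₂ : Bˣ) : Bˣ := (k₁⁻¹) ^ 3 * k₂ ^ 2

namespace BorelG2Sat

variable {B : Type*} [Ring B] [Algebra ℂ B] {r s : ℂˣ} {e₁ e₂ : B} {k₁ k₂ : Bˣ}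

theorem w₁_e₁ (h : BorelG2Sat r s e₁ e₂ k₁ k₂) :
    (wUnit₁ k₁ k₂ : B) * e₁ = ((r : ℂ) * (s : ℂ)⁻¹) • (e₁ * (wUnit₁ k₁ k₂ : B)) := by
  have hr : (r : ℂ) ≠ 0 := r.ne_zero
  have hs : (s : ℂ) ≠ 0 := s.ne_zero
  simp only [wUnit₁, Units.val_mul, Units.val_pow_eq_pow_val]
  rw [qcomm_mul (qcomm_pow h.k₁_e₁ 2) (qcomm_inv (by positivity) h.k₂_e₁)]
  congr 1
  field_simp

theorem w₁_e₂ (h : BorelG2Sat r s e₁ e₂ k₁ k₂) :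
    (wUnit₁ k₁ k₂ : B) * e₂ = ((s : ℂ) ^ 3) • (e₂ * (wUnit₁ k₁ k₂ : B)) := by
  have hr : (r : ℂ) ≠ 0 := r.ne_zero
  have hs : (s : ℂ) ≠ 0 := s.ne_zero
  simp only [wUnit₁, Units.val_mul, Units.val_pow_eq_pow_val]
  rw [qcomm_mul (qcomm_pow h.k₁_e₂ 2) (qcomm_inv (by positivity) h.k₂_e₂)]
  congr 1
  field_simp

theorem w₂_e₁ (h : BorelG2Sat r s e₁ e₂ k₁ k₂) :
    (wUnit₂ k₁ k₂ : B) * e₁ = ((r : ℂ)⁻¹ ^ 3) • (e₁ * (wUnit₂ k₁ k₂ : B)) := by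
  have hr : (r : ℂ) ≠ 0 := r.ne_zero
  have hs : (s : ℂ) ≠ 0 := s.ne_zero
  simp only [wUnit₂, Units.val_mul, Units.val_pow_eq_pow_val]
  rw [qcomm_mul (qcomm_pow (qcomm_inv (by positivity) h.k₁_e₁) 3) (qcomm_pow h.k₂_e₁ 2)]
  congr 1
  field_simp

theorem w₂_e₂ (h : BorelG2Sat r s e₁ e₂ k₁ k₂) :
    (wUnit₂ k₁ k₂ : B) * e₂ = ((r : ℂ) ^ 3 * (s : ℂ)⁻¹ ^ 3) • (e₂ * (wUnit₂ k₁ k₂ : B)) := by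
  have hr : (r : ℂ) ≠ 0 := r.ne_zero
  have hs : (s : ℂ) ≠ 0 := s.ne_zero
  simp only [wUnit₂, Units.val_mul, Units.val_pow_eq_pow_val]
  rw [qcomm_mul (qcomm_pow (qcomm_inv (by positivity) h.k₁_e₂) 3) (qcomm_pow h.k₂_e₂ 2)]
  congr 1
  field_simp

theorem commute (h : BorelG2Sat r s e₁ e₂ k₁ k₂) : Commute k₁ k₂ := Units.ext h.k₁_k₂

theorem commute_w (h : BorelG2Sat r s e₁ e₂ k₁ k₂) :
    Commute (wUnit₁ k₁ k₂) (wUnit₂ k₁ k₂) := by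
  have h12 := h.commute
  have h1 : Commute k₁ (wUnit₂ k₁ k₂) :=
    (((Commute.refl k₁).inv_right).pow_right 3).mul_right (h12.pow_right 2)
  have h2 : Commute k₂ (wUnit₂ k₁ k₂) :=
    ((h12.symm.inv_right).pow_right 3).mul_right ((Commute.refl k₂).pow_right 2)
  exact (h1.pow_left 2).mul_left h2.inv_left

theorem commute_k₁_w₁ (h : BorelG2Sat r s e₁ e₂ k₁ k₂) : Commute k₁ (wUnit₁ k₁ k₂) :=
  ((Commute.refl k₁).pow_right 2).mul_right h.commute.inv_right

theorem commute_k₂_w₁ (h : BorelG2Sat r s e₁ e₂ k₁ k₂) : Commute k₂ (wUnit₁ k₁ k₂) :=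
  (h.commute.symm.pow_right 2).mul_right (Commute.refl k₂).inv_right

theorem commute_k₁_w₂ (h : BorelG2Sat r s e₁ e₂ k₁ k₂) : Commute k₁ (wUnit₂ k₁ k₂) :=
  (((Commute.refl k₁).inv_right).pow_right 3).mul_right (h.commute.pow_right 2)

theorem commute_k₂_w₂ (h : BorelG2Sat r s e₁ e₂ k₁ k₂) : Commute k₂ (wUnit₂ k₁ k₂) :=
  ((h.commute.symm.inv_right).pow_right 3).mul_right ((Commute.refl k₂).pow_right 2)

end BorelG2Sat

namespace BorelG2

variable {r s : ℂˣ}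

instance : Ring (BorelG2 r s) := inferInstanceAs (Ring (RingQuot (BorelG2Rel r s)))

instance instAlgebra : Algebra ℂ (BorelG2 r s) :=
  inferInstanceAs (Algebra ℂ (RingQuot (BorelG2Rel r s)))

/-- The quotient map from the free algebra. -/
def mk (r s : ℂˣ) : FreeAlgebra ℂ BorelG2Gen →ₐ[ℂ] BorelG2 r s :=
  RingQuot.mkAlgHom ℂ (BorelG2Rel r s)

theorem mk_rel {x y : FreeAlgebra ℂ BorelG2Gen} (h : BorelG2Rel r s x y) : mk r s x = mk r s y :=
  RingQuot.mkAlgHom_rel ℂ h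

theorem mk_surjective : Function.Surjective (mk r s) := RingQuot.mkAlgHom_surjective ℂ _

/-- The generator `e₁`. -/
def e₁ (r s : ℂˣ) : BorelG2 r s := mk r s (FreeAlgebra.ι ℂ .e₁)

/-- The generator `e₂`. -/
def e₂ (r s : ℂˣ) : BorelG2 r s := mk r s (FreeAlgebra.ι ℂ .e₂)

/-- The generator `k₁`, with its inverse. -/
def k₁ (r s : ℂˣ) : (BorelG2 r s)ˣ where
  val := mk r s (FreeAlgebra.ι ℂ .k₁)
  inv := mk r s (FreeAlgebra.ι ℂ .k₁inv)
  val_inv := by rw [← map_mul, mk_rel .k₁_mul_inv, map_one]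
  inv_val := by rw [← map_mul, mk_rel .k₁_inv_mul, map_one]

/-- The generator `k₂`, with its inverse. -/
def k₂ (r s : ℂˣ) : (BorelG2 r s)ˣ where
  val := mk r s (FreeAlgebra.ι ℂ .k₂)
  inv := mk r s (FreeAlgebra.ι ℂ .k₂inv)
  val_inv := by rw [← map_mul, mk_rel .k₂_mul_inv, map_one]
  inv_val := by rw [← map_mul, mk_rel .k₂_inv_mul, map_one]

/-- The element `w₁ = k₁²k₂⁻¹`. -/
def w₁ (r s : ℂˣ) : (BorelG2 r s)ˣ := wUnit₁ (k₁ r s) (k₂ r s)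

/-- The element `w₂ = k₁⁻³k₂²`. -/
def w₂ (r s : ℂˣ) : (BorelG2 r s)ˣ := wUnit₂ (k₁ r s) (k₂ r s)

theorem sat (r s : ℂˣ) : BorelG2Sat r s (e₁ r s) (e₂ r s) (k₁ r s) (k₂ r s) where
  k₁_k₂ := by
    have := mk_rel (BorelG2Rel.k₁_k₂ (r := r) (s := s))
    simp only [map_mul] at this
    exact this
  k₁_e₁ := by
    have := mk_rel (BorelG2Rel.k₁_e₁ (r := r) (s := s))
    simp only [map_mul, map_smul] at this
    exact this
  k₁_e₂ := by
    have := mk_rel (BorelG2Rel.k₁_e₂ (r := r) (s := s))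
    simp only [map_mul, map_smul] at this
    exact this
  k₂_e₁ := by
    have := mk_rel (BorelG2Rel.k₂_e₁ (r := r) (s := s))
    simp only [map_mul, map_smul] at this
    exact this
  k₂_e₂ := by
    have := mk_rel (BorelG2Rel.k₂_e₂ (r := r) (s := s))
    simp only [map_mul, map_smul] at this
    exact this
  serre₂ := by
    have := mk_rel (BorelG2Rel.serre₂ (r := r) (s := s))
    rwa [map_serreQuadratic, map_zero] at this
  serre₄ := by
    have := mk_rel (BorelG2Rel.serre₄ (r := r) (s := s))
    rwa [map_serreQuartic, map_zero] at this

section Lift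

variable {B : Type*} [Ring B] [Algebra ℂ B]

/-- The values of a homomorphism on the generators. -/
def genMap (E₁ E₂ : B) (K₁ K₂ : Bˣ) : BorelG2Gen → B
  | .e₁ => E₁
  | .e₂ => E₂
  | .k₁ => K₁
  | .k₂ => K₂
  | .k₁inv => (K₁⁻¹ : Bˣ)
  | .k₂inv => (K₂⁻¹ : Bˣ)

/-- The universal property: elements that satisfy the relations define a homomorphism. -/
def lift {E₁ E₂ : B} {K₁ K₂ : Bˣ} (h : BorelG2Sat r s E₁ E₂ K₁ K₂) : BorelG2 r s →ₐ[ℂ] B :=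
  RingQuot.liftAlgHom ℂ ⟨FreeAlgebra.lift ℂ (genMap E₁ E₂ K₁ K₂), by
    intro x y hxy
    cases hxy
    case serre₂ => simpa [map_serreQuadratic, genMap] using h.serre₂
    case serre₄ => simpa [map_serreQuartic, genMap] using h.serre₄
    case k₁_k₂ => simpa [genMap] using h.k₁_k₂
    case k₁_e₁ =>
      simpa only [map_mul, map_smul, FreeAlgebra.lift_ι_apply, genMap] using h.k₁_e₁
    case k₁_e₂ =>
      simpa only [map_mul, map_smul, FreeAlgebra.lift_ι_apply, genMap] using h.k₁_e₂
    case k₂_e₁ =>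
      simpa only [map_mul, map_smul, FreeAlgebra.lift_ι_apply, genMap] using h.k₂_e₁
    case k₂_e₂ =>
      simpa only [map_mul, map_smul, FreeAlgebra.lift_ι_apply, genMap] using h.k₂_e₂
    all_goals simp [genMap]⟩

variable {E₁ E₂ : B} {K₁ K₂ : Bˣ} (h : BorelG2Sat r s E₁ E₂ K₁ K₂)

theorem lift_mk (x : FreeAlgebra ℂ BorelG2Gen) :
    lift h (mk r s x) = FreeAlgebra.lift ℂ (genMap E₁ E₂ K₁ K₂) x :=
  RingQuot.liftAlgHom_mkAlgHom_apply ℂ _ _ _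

@[simp] theorem lift_e₁ : lift h (e₁ r s) = E₁ := by simp [e₁, lift_mk, genMap]

@[simp] theorem lift_e₂ : lift h (e₂ r s) = E₂ := by simp [e₂, lift_mk, genMap]

@[simp] theorem lift_k₁ : lift h (k₁ r s : BorelG2 r s) = K₁ := by simp [k₁, lift_mk, genMap]

@[simp] theorem lift_k₂ : lift h (k₂ r s : BorelG2 r s) = K₂ := by simp [k₂, lift_mk, genMap]

@[simp] theorem map_lift_k₁ : Units.map (lift h : BorelG2 r s →* B) (k₁ r s) = K₁ :=
  Units.ext (lift_k₁ h)

@[simp] theorem map_lift_k₂ : Units.map (lift h : BorelG2 r s →* B) (k₂ r s) = K₂ :=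
  Units.ext (lift_k₂ h)

@[simp] theorem lift_k₁_inv : lift h ((k₁ r s)⁻¹ : (BorelG2 r s)ˣ) = (K₁⁻¹ : Bˣ) := by
  exact congrArg (fun u : Bˣ => ((u⁻¹ : Bˣ) : B)) (map_lift_k₁ h)

@[simp] theorem lift_k₂_inv : lift h ((k₂ r s)⁻¹ : (BorelG2 r s)ˣ) = (K₂⁻¹ : Bˣ) := by
  exact congrArg (fun u : Bˣ => ((u⁻¹ : Bˣ) : B)) (map_lift_k₂ h)

@[simp] theorem lift_w₁ : lift h (w₁ r s : BorelG2 r s) = wUnit₁ K₁ K₂ := by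
  simp [w₁, wUnit₁]

@[simp] theorem lift_w₂ : lift h (w₂ r s : BorelG2 r s) = wUnit₂ K₁ K₂ := by
  simp [w₂, wUnit₂]

end Lift

theorem hom_ext {B : Type*} [Ring B] [Algebra ℂ B] {f g : BorelG2 r s →ₐ[ℂ] B}
    (h₁ : f (e₁ r s) = g (e₁ r s)) (h₂ : f (e₂ r s) = g (e₂ r s))
    (h₃ : f (k₁ r s) = g (k₁ r s)) (h₄ : f (k₂ r s) = g (k₂ r s)) : f = g := by
  have h₅ : Units.map (f : BorelG2 r s →* B) (k₁ r s) = Units.map (g : BorelG2 r s →* B) (k₁ r s) :=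
    Units.ext h₃
  have h₆ : Units.map (f : BorelG2 r s →* B) (k₂ r s) = Units.map (g : BorelG2 r s →* B) (k₂ r s) :=
    Units.ext h₄
  have h : f.comp (mk r s) = g.comp (mk r s) := by
    apply FreeAlgebra.hom_ext
    funext x
    cases x
    · exact h₁
    · exact h₂
    · exact h₃
    · exact h₄
    · exact congrArg (fun u : Bˣ => ((u⁻¹ : Bˣ) : B)) h₅
    · exact congrArg (fun u : Bˣ => ((u⁻¹ : Bˣ) : B)) h₆
  ext x
  obtain ⟨y, rfl⟩ := mk_surjective x
  exact DFunLike.congr_fun h y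

theorem induction {P : BorelG2 r s → Prop} (hc : ∀ c : ℂ, P (algebraMap ℂ _ c))
    (he₁ : P (e₁ r s)) (he₂ : P (e₂ r s)) (hk₁ : P (k₁ r s)) (hk₂ : P (k₂ r s))
    (hk₁i : P ((k₁ r s)⁻¹ : (BorelG2 r s)ˣ)) (hk₂i : P ((k₂ r s)⁻¹ : (BorelG2 r s)ˣ))
    (hmul : ∀ x y, P x → P y → P (x * y)) (hadd : ∀ x y, P x → P y → P (x + y))
    (x : BorelG2 r s) : P x := by
  obtain ⟨y, rfl⟩ := mk_surjective x
  induction y using FreeAlgebra.induction with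
  | grade0 c => simpa using hc c
  | grade1 x =>
    cases x
    · exact he₁
    · exact he₂
    · exact hk₁
    · exact hk₂
    · exact hk₁i
    · exact hk₂i
  | mul a b ha hb => rw [map_mul]; exact hmul _ _ ha hb
  | add a b ha hb => rw [map_add]; exact hadd _ _ ha hb

/-! Comultiplication, counit and antipode -/

/-- `u ⊗ v` for units `u` and `v`. -/
def tmulUnit {A B : Type*} [Ring A] [Algebra ℂ A] [Ring B] [Algebra ℂ B] (u : Aˣ) (v : Bˣ) :
    (A ⊗[ℂ] B)ˣ where
  val := (u : A) ⊗ₜ (v : B)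
  inv := ((u⁻¹ : Aˣ) : A) ⊗ₜ ((v⁻¹ : Bˣ) : B)
  val_inv := by simp [Algebra.TensorProduct.one_def]
  inv_val := by simp [Algebra.TensorProduct.one_def]

/-- `u⁻¹` as a unit of the opposite algebra. -/
def opInvUnit {A : Type*} [Ring A] (u : Aˣ) : (Aᵐᵒᵖ)ˣ where
  val := MulOpposite.op ((u⁻¹ : Aˣ) : A)
  inv := MulOpposite.op (u : A)
  val_inv := by rw [← MulOpposite.op_mul, Units.mul_inv, MulOpposite.op_one]
  inv_val := by rw [← MulOpposite.op_mul, Units.inv_mul, MulOpposite.op_one]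

theorem sat_comul (r s : ℂˣ) : BorelG2Sat r s
    (e₁ r s ⊗ₜ[ℂ] (1 : BorelG2 r s) + (w₁ r s : BorelG2 r s) ⊗ₜ[ℂ] e₁ r s)
    (e₂ r s ⊗ₜ[ℂ] (1 : BorelG2 r s) + (w₂ r s : BorelG2 r s) ⊗ₜ[ℂ] e₂ r s)
    (tmulUnit (k₁ r s) (k₁ r s)) (tmulUnit (k₂ r s) (k₂ r s)) := by
  have h := sat r s
  have c11 : (k₁ r s : BorelG2 r s) * w₁ r s = w₁ r s * k₁ r s := congrArg Units.val h.commute_k₁_w₁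
  have c21 : (k₂ r s : BorelG2 r s) * w₁ r s = w₁ r s * k₂ r s := congrArg Units.val h.commute_k₂_w₁
  have c12 : (k₁ r s : BorelG2 r s) * w₂ r s = w₂ r s * k₁ r s := congrArg Units.val h.commute_k₁_w₂
  have c22 : (k₂ r s : BorelG2 r s) * w₂ r s = w₂ r s * k₂ r s := congrArg Units.val h.commute_k₂_w₂
  have cww : (w₁ r s : BorelG2 r s) * w₂ r s = w₂ r s * w₁ r s := congrArg Units.val h.commute_w
  have w11 : (w₁ r s : BorelG2 r s) * e₁ r s = ((r : ℂ) * (s : ℂ)⁻¹) • (e₁ r s * w₁ r s) :=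
    h.w₁_e₁
  have w12 : (w₁ r s : BorelG2 r s) * e₂ r s = ((s : ℂ) ^ 3) • (e₂ r s * w₁ r s) :=
    h.w₁_e₂
  have w21 : (w₂ r s : BorelG2 r s) * e₁ r s = ((r : ℂ)⁻¹ ^ 3) • (e₁ r s * w₂ r s) :=
    h.w₂_e₁
  have w22 : (w₂ r s : BorelG2 r s) * e₂ r s = ((r : ℂ) ^ 3 * (s : ℂ)⁻¹ ^ 3) • (e₂ r s * w₂ r s) :=
    h.w₂_e₂
  refine ⟨?_, ?_, ?_, ?_, ?_, ?_, ?_⟩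
  · simp only [tmulUnit, Algebra.TensorProduct.tmul_mul_tmul, h.k₁_k₂]
  · simp only [tmulUnit, Algebra.TensorProduct.tmul_mul_tmul, mul_add, add_mul, h.k₁_e₁, c11,
      mul_one, one_mul, TensorProduct.smul_tmul', TensorProduct.tmul_smul, smul_add]
  · simp only [tmulUnit, Algebra.TensorProduct.tmul_mul_tmul, mul_add, add_mul, h.k₁_e₂, c12,
      mul_one, one_mul, TensorProduct.smul_tmul', TensorProduct.tmul_smul, smul_add]
  · simp only [tmulUnit, Algebra.TensorProduct.tmul_mul_tmul, mul_add, add_mul, h.k₂_e₁, c21,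
      mul_one, one_mul, TensorProduct.smul_tmul', TensorProduct.tmul_smul, smul_add]
  · simp only [tmulUnit, Algebra.TensorProduct.tmul_mul_tmul, mul_add, add_mul, h.k₂_e₂, c22,
      mul_one, one_mul, TensorProduct.smul_tmul', TensorProduct.tmul_smul, smul_add]
  · rw [serreQuadratic_add]
    · have h1 := map_serreQuadratic (Algebra.TensorProduct.includeLeft :
        BorelG2 r s →ₐ[ℂ] BorelG2 r s ⊗[ℂ] BorelG2 r s) r s (e₁ r s) (e₂ r s)
      rw [h.serre₂, map_zero] at h1
      simp only [Algebra.TensorProduct.includeLeft_apply] at h1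
      rw [← h1, zero_add]
      have h2 : serreQuadratic r s ((w₁ r s : BorelG2 r s) ⊗ₜ[ℂ] e₁ r s)
          ((w₂ r s : BorelG2 r s) ⊗ₜ[ℂ] e₂ r s) =
          ((w₁ r s : BorelG2 r s) * w₂ r s ^ 2) ⊗ₜ[ℂ] serreQuadratic r s (e₁ r s) (e₂ r s) := by
        have e1 : (w₂ r s : BorelG2 r s) ^ 2 * w₁ r s = w₁ r s * w₂ r s ^ 2 := by
          rw [((show Commute (w₁ r s : BorelG2 r s) (w₂ r s) from cww).pow_right 2).eq]
        have e2 : (w₂ r s : BorelG2 r s) * w₁ r s * w₂ r s = w₁ r s * w₂ r s ^ 2 := by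
          rw [← cww, mul_assoc, pow_two]
        simp only [serreQuadratic, Algebra.TensorProduct.tmul_mul_tmul,
          Algebra.TensorProduct.tmul_pow, TensorProduct.tmul_add, TensorProduct.tmul_sub,
          TensorProduct.tmul_smul, e1, e2]
      rw [h2, h.serre₂, TensorProduct.tmul_zero]
    · simp only [Algebra.TensorProduct.tmul_mul_tmul, w22, mul_one, one_mul,
        TensorProduct.smul_tmul']
    · simp only [Algebra.TensorProduct.tmul_mul_tmul, w12, mul_one, one_mul,
        TensorProduct.smul_tmul']
    · simp only [Algebra.TensorProduct.tmul_mul_tmul, w21, mul_one, one_mul,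
        TensorProduct.smul_tmul']
  · rw [serreQuartic_add]
    · have h1 := map_serreQuartic (Algebra.TensorProduct.includeLeft :
        BorelG2 r s →ₐ[ℂ] BorelG2 r s ⊗[ℂ] BorelG2 r s) r s (e₁ r s) (e₂ r s)
      rw [h.serre₄, map_zero] at h1
      simp only [Algebra.TensorProduct.includeLeft_apply] at h1
      rw [← h1, zero_add]
      have h2 : serreQuartic r s ((w₁ r s : BorelG2 r s) ⊗ₜ[ℂ] e₁ r s)
          ((w₂ r s : BorelG2 r s) ⊗ₜ[ℂ] e₂ r s) =
          ((w₁ r s : BorelG2 r s) ^ 4 * w₂ r s) ⊗ₜ[ℂ] serreQuartic r s (e₁ r s) (e₂ r s) := by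
        have key : ∀ i j : ℕ, (w₁ r s : BorelG2 r s) ^ i * w₂ r s * w₁ r s ^ j =
            w₁ r s ^ (i + j) * w₂ r s := by
          intro i j
          rw [mul_assoc, ← ((show Commute (w₁ r s : BorelG2 r s) (w₂ r s) from cww).pow_left j).eq,
            ← mul_assoc, pow_add]
        have e1 := key 3 1
        have e2 := key 2 2
        have e3 := key 1 3
        have e4 := key 0 4
        simp only [pow_one, pow_zero, one_mul, Nat.reduceAdd] at e1 e2 e3 e4
        simp only [serreQuartic, Algebra.TensorProduct.tmul_mul_tmul,
          Algebra.TensorProduct.tmul_pow, TensorProduct.tmul_add, TensorProduct.tmul_sub,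
          TensorProduct.tmul_smul, e1, e2, e3, e4]
      rw [h2, h.serre₄, TensorProduct.tmul_zero]
    · simp only [Algebra.TensorProduct.tmul_mul_tmul, w11, mul_one, one_mul,
        TensorProduct.smul_tmul']
    · simp only [Algebra.TensorProduct.tmul_mul_tmul, w12, mul_one, one_mul,
        TensorProduct.smul_tmul']
    · simp only [Algebra.TensorProduct.tmul_mul_tmul, w21, mul_one, one_mul,
        TensorProduct.smul_tmul']

theorem sat_counit (r s : ℂˣ) : BorelG2Sat r s (0 : ℂ) 0 1 1 := by
  constructor <;> simp [serreQuadratic, serreQuartic]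

open MulOpposite in
theorem sat_antipode (r s : ℂˣ) : BorelG2Sat r s
    (op (-(((w₁ r s)⁻¹ : (BorelG2 r s)ˣ) * e₁ r s)))
    (op (-(((w₂ r s)⁻¹ : (BorelG2 r s)ˣ) * e₂ r s)))
    (opInvUnit (k₁ r s)) (opInvUnit (k₂ r s)) := by
  have h := sat r s
  have hr : (r : ℂ) ≠ 0 := r.ne_zero
  have hs : (s : ℂ) ≠ 0 := s.ne_zero
  have inv_r : ∀ {k : (BorelG2 r s)ˣ} {x : BorelG2 r s} {q : ℂ}, q ≠ 0 →
      (k : BorelG2 r s) * x = q • (x * k) →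
      x * (k⁻¹ : (BorelG2 r s)ˣ) = q • ((k⁻¹ : (BorelG2 r s)ˣ) * x) := by
    intro k x q hq hk
    rw [qcomm_inv hq hk, smul_smul, mul_inv_cancel₀ hq, one_smul]
  have kk : ∀ {k w : (BorelG2 r s)ˣ} {x : BorelG2 r s} {q : ℂ}, q ≠ 0 → Commute k w →
      (k : BorelG2 r s) * x = q • (x * k) →
      ((w⁻¹ : (BorelG2 r s)ˣ) * x) * (k⁻¹ : (BorelG2 r s)ˣ) =
        q • ((k⁻¹ : (BorelG2 r s)ˣ) * ((w⁻¹ : (BorelG2 r s)ˣ) * x)) := by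
    intro k w x q hq hc hk
    have hc' : ((w⁻¹ : (BorelG2 r s)ˣ) : BorelG2 r s) * (k⁻¹ : (BorelG2 r s)ˣ) =
      (k⁻¹ : (BorelG2 r s)ˣ) * (w⁻¹ : (BorelG2 r s)ˣ) := congrArg Units.val hc.symm.inv_inv
    rw [mul_assoc, inv_r hq hk, mul_smul_comm, ← mul_assoc, hc', mul_assoc]
  have cww : (((w₂ r s)⁻¹ : (BorelG2 r s)ˣ) : BorelG2 r s) * ((w₁ r s)⁻¹ : (BorelG2 r s)ˣ) =
      ((w₁ r s)⁻¹ : (BorelG2 r s)ˣ) * ((w₂ r s)⁻¹ : (BorelG2 r s)ˣ) :=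
    congrArg Units.val h.commute_w.symm.inv_inv
  have w11 : e₁ r s * ((w₁ r s)⁻¹ : (BorelG2 r s)ˣ) =
      ((r : ℂ) * (s : ℂ)⁻¹) • (((w₁ r s)⁻¹ : (BorelG2 r s)ˣ) * e₁ r s) :=
    inv_r (by positivity) h.w₁_e₁
  have w12 : e₂ r s * ((w₁ r s)⁻¹ : (BorelG2 r s)ˣ) =
      ((s : ℂ) ^ 3) • (((w₁ r s)⁻¹ : (BorelG2 r s)ˣ) * e₂ r s) :=
    inv_r (by positivity) h.w₁_e₂
  have w21 : e₁ r s * ((w₂ r s)⁻¹ : (BorelG2 r s)ˣ) =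
      ((r : ℂ)⁻¹ ^ 3) • (((w₂ r s)⁻¹ : (BorelG2 r s)ˣ) * e₁ r s) :=
    inv_r (by positivity) h.w₂_e₁
  have w22 : e₂ r s * ((w₂ r s)⁻¹ : (BorelG2 r s)ˣ) =
      ((r : ℂ) ^ 3 * (s : ℂ)⁻¹ ^ 3) • (((w₂ r s)⁻¹ : (BorelG2 r s)ˣ) * e₂ r s) :=
    inv_r (by positivity) h.w₂_e₂
  refine ⟨?_, ?_, ?_, ?_, ?_, ?_, ?_⟩
  · exact congrArg (fun u : (BorelG2 r s)ˣ => op (u : BorelG2 r s)) h.commute.symm.inv_inv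
  · apply unop_injective
    simpa only [opInvUnit, unop_mul, unop_smul, unop_op, mul_neg, neg_mul, smul_neg, neg_inj]
      using kk (by positivity) (w := w₁ r s) h.commute_k₁_w₁ h.k₁_e₁
  · apply unop_injective
    simpa only [opInvUnit, unop_mul, unop_smul, unop_op, mul_neg, neg_mul, smul_neg, neg_inj]
      using kk (by positivity) (w := w₂ r s) h.commute_k₁_w₂ h.k₁_e₂
  · apply unop_injective
    simpa only [opInvUnit, unop_mul, unop_smul, unop_op, mul_neg, neg_mul, smul_neg, neg_inj]
      using kk (by positivity) (w := w₁ r s) h.commute_k₂_w₁ h.k₂_e₁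
  · apply unop_injective
    simpa only [opInvUnit, unop_mul, unop_smul, unop_op, mul_neg, neg_mul, smul_neg, neg_inj]
      using kk (by positivity) (w := w₂ r s) h.commute_k₂_w₂ h.k₂_e₂
  · rw [serreQuadratic_op r s cww w21 w12 w22, h.serre₂]
    simp
  · rw [serreQuartic_op r s cww w11 w21 w12, h.serre₄]
    simp

/-- The comultiplication: `Δ(e₁) = e₁ ⊗ 1 + k₁²k₂⁻¹ ⊗ e₁`, `Δ(e₂) = e₂ ⊗ 1 + k₁⁻³k₂² ⊗ e₂`,
`Δ(kₗ) = kₗ ⊗ kₗ`. -/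
def comulHom (r s : ℂˣ) : BorelG2 r s →ₐ[ℂ] BorelG2 r s ⊗[ℂ] BorelG2 r s := lift (sat_comul r s)

/-- The counit: `ε(eₗ) = 0`, `ε(kₗ) = 1`. -/
def counitHom (r s : ℂˣ) : BorelG2 r s →ₐ[ℂ] ℂ := lift (sat_counit r s)

/-- The antipode as a homomorphism to the opposite algebra: `S(e₁) = -(k₁²k₂⁻¹)⁻¹e₁`,
`S(e₂) = -(k₁⁻³k₂²)⁻¹e₂`, `S(kₗ) = kₗ⁻¹`. -/
def antipodeHom (r s : ℂˣ) : BorelG2 r s →ₐ[ℂ] (BorelG2 r s)ᵐᵒᵖ := lift (sat_antipode r s)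

theorem wUnit₁_tmulUnit {A : Type*} [Ring A] [Algebra ℂ A] (u v : Aˣ) :
    wUnit₁ (tmulUnit u u) (tmulUnit v v) = tmulUnit (wUnit₁ u v) (wUnit₁ u v) := by
  apply Units.ext
  have h : (((tmulUnit v v)⁻¹ : (A ⊗[ℂ] A)ˣ) : A ⊗[ℂ] A) =
    ((v⁻¹ : Aˣ) : A) ⊗ₜ ((v⁻¹ : Aˣ) : A) := rfl
  simp only [wUnit₁, Units.val_mul, Units.val_pow_eq_pow_val, h]
  simp [tmulUnit]

theorem wUnit₂_tmulUnit {A : Type*} [Ring A] [Algebra ℂ A] (u v : Aˣ) :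
    wUnit₂ (tmulUnit u u) (tmulUnit v v) = tmulUnit (wUnit₂ u v) (wUnit₂ u v) := by
  apply Units.ext
  have h : (((tmulUnit u u)⁻¹ : (A ⊗[ℂ] A)ˣ) : A ⊗[ℂ] A) =
    ((u⁻¹ : Aˣ) : A) ⊗ₜ ((u⁻¹ : Aˣ) : A) := rfl
  simp only [wUnit₂, Units.val_mul, Units.val_pow_eq_pow_val, h]
  simp [tmulUnit]

theorem comulHom_e₁ : comulHom r s (e₁ r s) =
    e₁ r s ⊗ₜ[ℂ] (1 : BorelG2 r s) + (w₁ r s : BorelG2 r s) ⊗ₜ[ℂ] e₁ r s := lift_e₁ _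

theorem comulHom_e₂ : comulHom r s (e₂ r s) =
    e₂ r s ⊗ₜ[ℂ] (1 : BorelG2 r s) + (w₂ r s : BorelG2 r s) ⊗ₜ[ℂ] e₂ r s := lift_e₂ _

theorem comulHom_k₁ : comulHom r s (k₁ r s : BorelG2 r s) =
    (k₁ r s : BorelG2 r s) ⊗ₜ[ℂ] (k₁ r s : BorelG2 r s) := lift_k₁ _

theorem comulHom_k₂ : comulHom r s (k₂ r s : BorelG2 r s) =
    (k₂ r s : BorelG2 r s) ⊗ₜ[ℂ] (k₂ r s : BorelG2 r s) := lift_k₂ _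

theorem comulHom_k₁_inv : comulHom r s ((k₁ r s)⁻¹ : (BorelG2 r s)ˣ) =
    (((k₁ r s)⁻¹ : (BorelG2 r s)ˣ) : BorelG2 r s) ⊗ₜ[ℂ]
      (((k₁ r s)⁻¹ : (BorelG2 r s)ˣ) : BorelG2 r s) := lift_k₁_inv _

theorem comulHom_k₂_inv : comulHom r s ((k₂ r s)⁻¹ : (BorelG2 r s)ˣ) =
    (((k₂ r s)⁻¹ : (BorelG2 r s)ˣ) : BorelG2 r s) ⊗ₜ[ℂ]
      (((k₂ r s)⁻¹ : (BorelG2 r s)ˣ) : BorelG2 r s) := lift_k₂_inv _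

theorem comulHom_w₁ : comulHom r s (w₁ r s : BorelG2 r s) =
    (w₁ r s : BorelG2 r s) ⊗ₜ[ℂ] (w₁ r s : BorelG2 r s) := by
  rw [comulHom, lift_w₁, wUnit₁_tmulUnit]; rfl

theorem comulHom_w₂ : comulHom r s (w₂ r s : BorelG2 r s) =
    (w₂ r s : BorelG2 r s) ⊗ₜ[ℂ] (w₂ r s : BorelG2 r s) := by
  rw [comulHom, lift_w₂, wUnit₂_tmulUnit]; rfl

theorem counitHom_e₁ : counitHom r s (e₁ r s) = 0 := lift_e₁ _

theorem counitHom_e₂ : counitHom r s (e₂ r s) = 0 := lift_e₂ _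

theorem counitHom_k₁ : counitHom r s (k₁ r s : BorelG2 r s) = 1 := lift_k₁ _

theorem counitHom_k₂ : counitHom r s (k₂ r s : BorelG2 r s) = 1 := lift_k₂ _

theorem counitHom_k₁_inv : counitHom r s ((k₁ r s)⁻¹ : (BorelG2 r s)ˣ) = 1 := by
  rw [counitHom, lift_k₁_inv, inv_one, Units.val_one]

theorem counitHom_k₂_inv : counitHom r s ((k₂ r s)⁻¹ : (BorelG2 r s)ˣ) = 1 := by
  rw [counitHom, lift_k₂_inv, inv_one, Units.val_one]

theorem counitHom_w₁ : counitHom r s (w₁ r s : BorelG2 r s) = 1 := by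
  rw [counitHom, lift_w₁]; simp [wUnit₁]

theorem counitHom_w₂ : counitHom r s (w₂ r s : BorelG2 r s) = 1 := by
  rw [counitHom, lift_w₂]; simp [wUnit₂]

instance instBialgebra (r s : ℂˣ) : Bialgebra ℂ (BorelG2 r s) :=
  Bialgebra.ofAlgHom (comulHom r s) (counitHom r s)
    (by
      apply hom_ext <;>
      simp [comulHom_e₁, comulHom_e₂, comulHom_k₁, comulHom_k₂, comulHom_w₁, comulHom_w₂,
        TensorProduct.add_tmul, TensorProduct.tmul_add, Algebra.TensorProduct.one_def, add_assoc])
    (by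
      apply hom_ext <;>
      simp [comulHom_e₁, comulHom_e₂, comulHom_k₁, comulHom_k₂, counitHom_w₁, counitHom_w₂,
        counitHom_e₁, counitHom_e₂, counitHom_k₁, counitHom_k₂])
    (by
      apply hom_ext <;>
      simp [comulHom_e₁, comulHom_e₂, comulHom_k₁, comulHom_k₂,
        counitHom_e₁, counitHom_e₂, counitHom_k₁, counitHom_k₂])

/-- The antipode as a linear map. -/
def antipodeMap (r s : ℂˣ) : BorelG2 r s →ₗ[ℂ] BorelG2 r s :=
  (MulOpposite.opLinearEquiv ℂ).symm.toLinearMap ∘ₗ (antipodeHom r s).toLinearMap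

theorem antipodeMap_apply (x : BorelG2 r s) :
    antipodeMap r s x = MulOpposite.unop (antipodeHom r s x) := rfl

theorem antipodeMap_mul (x y : BorelG2 r s) :
    antipodeMap r s (x * y) = antipodeMap r s y * antipodeMap r s x := by
  simp [antipodeMap_apply]

theorem antipodeMap_algebraMap (c : ℂ) :
    antipodeMap r s (algebraMap ℂ _ c) = algebraMap ℂ _ c := by
  rw [antipodeMap_apply, AlgHom.commutes]; rfl

theorem antipodeMap_one : antipodeMap r s 1 = 1 := by
  simpa using antipodeMap_algebraMap (r := r) (s := s) 1

theorem antipodeMap_e₁ : antipodeMap r s (e₁ r s) =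
    -(((w₁ r s)⁻¹ : (BorelG2 r s)ˣ) * e₁ r s) := by
  rw [antipodeMap_apply, antipodeHom, lift_e₁]; rfl

theorem antipodeMap_e₂ : antipodeMap r s (e₂ r s) =
    -(((w₂ r s)⁻¹ : (BorelG2 r s)ˣ) * e₂ r s) := by
  rw [antipodeMap_apply, antipodeHom, lift_e₂]; rfl

theorem antipodeMap_k₁ : antipodeMap r s (k₁ r s : BorelG2 r s) =
    ((k₁ r s)⁻¹ : (BorelG2 r s)ˣ) := by
  rw [antipodeMap_apply, antipodeHom, lift_k₁]; rfl

theorem antipodeMap_k₂ : antipodeMap r s (k₂ r s : BorelG2 r s) =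
    ((k₂ r s)⁻¹ : (BorelG2 r s)ˣ) := by
  rw [antipodeMap_apply, antipodeHom, lift_k₂]; rfl

theorem antipodeMap_k₁_inv : antipodeMap r s ((k₁ r s)⁻¹ : (BorelG2 r s)ˣ) = k₁ r s := by
  rw [antipodeMap_apply, antipodeHom, lift_k₁_inv]; rfl

theorem antipodeMap_k₂_inv : antipodeMap r s ((k₂ r s)⁻¹ : (BorelG2 r s)ˣ) = k₂ r s := by
  rw [antipodeMap_apply, antipodeHom, lift_k₂_inv]; rfl

theorem antipodeMap_w₁ : antipodeMap r s (w₁ r s : BorelG2 r s) =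
    ((w₁ r s)⁻¹ : (BorelG2 r s)ˣ) := by
  simp only [w₁, wUnit₁, pow_two, Units.val_mul, mul_inv_rev, inv_inv, antipodeMap_mul,
    antipodeMap_k₁, antipodeMap_k₂_inv]

theorem antipodeMap_w₂ : antipodeMap r s (w₂ r s : BorelG2 r s) =
    ((w₂ r s)⁻¹ : (BorelG2 r s)ˣ) := by
  simp only [w₂, wUnit₂, pow_succ, pow_zero, one_mul, Units.val_mul, mul_inv_rev, inv_inv,
    antipodeMap_mul, antipodeMap_k₂, antipodeMap_k₁_inv, mul_assoc]

/-- `x ⊗ y ↦ S(x)y`. -/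
def mulLeftAntipode (r s : ℂˣ) : BorelG2 r s ⊗[ℂ] BorelG2 r s →ₗ[ℂ] BorelG2 r s :=
  LinearMap.mul' ℂ (BorelG2 r s) ∘ₗ (antipodeMap r s).rTensor (BorelG2 r s)

/-- `x ⊗ y ↦ xS(y)`. -/
def mulRightAntipode (r s : ℂˣ) : BorelG2 r s ⊗[ℂ] BorelG2 r s →ₗ[ℂ] BorelG2 r s :=
  LinearMap.mul' ℂ (BorelG2 r s) ∘ₗ (antipodeMap r s).lTensor (BorelG2 r s)

theorem mulLeftAntipode_tmul (x y : BorelG2 r s) :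
    mulLeftAntipode r s (x ⊗ₜ y) = antipodeMap r s x * y := by simp [mulLeftAntipode]

theorem mulRightAntipode_tmul (x y : BorelG2 r s) :
    mulRightAntipode r s (x ⊗ₜ y) = x * antipodeMap r s y := by simp [mulRightAntipode]

theorem mulLeftAntipode_mul_tmul (t : BorelG2 r s ⊗[ℂ] BorelG2 r s) (x y : BorelG2 r s) :
    mulLeftAntipode r s (t * x ⊗ₜ y) = antipodeMap r s x * mulLeftAntipode r s t * y := by
  induction t using TensorProduct.induction_on with
  | zero => simp
  | tmul a b =>
    simp only [Algebra.TensorProduct.tmul_mul_tmul, mulLeftAntipode_tmul, antipodeMap_mul,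
      mul_assoc]
  | add a b ha hb => simp only [add_mul, mul_add, map_add, ha, hb]

theorem mulRightAntipode_tmul_mul (t : BorelG2 r s ⊗[ℂ] BorelG2 r s) (x y : BorelG2 r s) :
    mulRightAntipode r s (x ⊗ₜ y * t) = x * mulRightAntipode r s t * antipodeMap r s y := by
  induction t using TensorProduct.induction_on with
  | zero => simp
  | tmul a b =>
    simp only [Algebra.TensorProduct.tmul_mul_tmul, mulRightAntipode_tmul, antipodeMap_mul,
      mul_assoc]
  | add a b ha hb => simp only [add_mul, mul_add, map_add, ha, hb]

theorem mulLeftAntipode_mul {t : BorelG2 r s ⊗[ℂ] BorelG2 r s} {c : ℂ}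
    (h : mulLeftAntipode r s t = algebraMap ℂ _ c) (u : BorelG2 r s ⊗[ℂ] BorelG2 r s) :
    mulLeftAntipode r s (t * u) = algebraMap ℂ _ c * mulLeftAntipode r s u := by
  induction u using TensorProduct.induction_on with
  | zero => simp
  | tmul a b =>
    rw [mulLeftAntipode_mul_tmul, h, mulLeftAntipode_tmul, ← Algebra.commutes, mul_assoc]
  | add a b ha hb => simp only [mul_add, map_add, ha, hb]

theorem mulRightAntipode_mul {t : BorelG2 r s ⊗[ℂ] BorelG2 r s} {c : ℂ}
    (h : mulRightAntipode r s t = algebraMap ℂ _ c) (u : BorelG2 r s ⊗[ℂ] BorelG2 r s) :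
    mulRightAntipode r s (u * t) = mulRightAntipode r s u * algebraMap ℂ _ c := by
  induction u using TensorProduct.induction_on with
  | zero => simp
  | tmul a b =>
    rw [mulRightAntipode_tmul_mul, h, mulRightAntipode_tmul, mul_assoc, mul_assoc,
      Algebra.commutes]
  | add a b ha hb => simp only [add_mul, map_add, ha, hb]

theorem mulLeftAntipode_comulHom (x : BorelG2 r s) :
    mulLeftAntipode r s (comulHom r s x) = algebraMap ℂ _ (counitHom r s x) := by
  induction x using BorelG2.induction with
  | hc c =>
    rw [AlgHom.commutes, AlgHom.commutes, Algebra.TensorProduct.algebraMap_apply,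
      mulLeftAntipode_tmul, mul_one]
    exact antipodeMap_algebraMap c
  | he₁ => simp [comulHom_e₁, counitHom_e₁, mulLeftAntipode_tmul, antipodeMap_e₁, antipodeMap_w₁]
  | he₂ => simp [comulHom_e₂, counitHom_e₂, mulLeftAntipode_tmul, antipodeMap_e₂, antipodeMap_w₂]
  | hk₁ => simp [comulHom_k₁, counitHom_k₁, mulLeftAntipode_tmul, antipodeMap_k₁]
  | hk₂ => simp [comulHom_k₂, counitHom_k₂, mulLeftAntipode_tmul, antipodeMap_k₂]
  | hk₁i =>
    simp [comulHom_k₁_inv, counitHom_k₁, mulLeftAntipode_tmul, antipodeMap_k₁_inv]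
  | hk₂i =>
    simp [comulHom_k₂_inv, counitHom_k₂, mulLeftAntipode_tmul, antipodeMap_k₂_inv]
  | hmul x y hx hy => rw [map_mul, mulLeftAntipode_mul hx, hy, map_mul, map_mul]
  | hadd x y hx hy => simp only [map_add, hx, hy]

theorem mulRightAntipode_comulHom (x : BorelG2 r s) :
    mulRightAntipode r s (comulHom r s x) = algebraMap ℂ _ (counitHom r s x) := by
  induction x using BorelG2.induction with
  | hc c =>
    rw [AlgHom.commutes, AlgHom.commutes, Algebra.TensorProduct.algebraMap_apply,
      mulRightAntipode_tmul, antipodeMap_one, mul_one]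
    rfl
  | he₁ => simp [comulHom_e₁, counitHom_e₁, mulRightAntipode_tmul, antipodeMap_e₁, antipodeMap_one]
  | he₂ => simp [comulHom_e₂, counitHom_e₂, mulRightAntipode_tmul, antipodeMap_e₂, antipodeMap_one]
  | hk₁ => simp [comulHom_k₁, counitHom_k₁, mulRightAntipode_tmul, antipodeMap_k₁]
  | hk₂ => simp [comulHom_k₂, counitHom_k₂, mulRightAntipode_tmul, antipodeMap_k₂]
  | hk₁i =>
    simp [comulHom_k₁_inv, counitHom_k₁, mulRightAntipode_tmul, antipodeMap_k₁_inv]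
  | hk₂i =>
    simp [comulHom_k₂_inv, counitHom_k₂, mulRightAntipode_tmul, antipodeMap_k₂_inv]
  | hmul x y hx hy => rw [map_mul, mulRightAntipode_mul hy, hx, map_mul, map_mul]
  | hadd x y hx hy => simp only [map_add, hx, hy]

instance instHopfAlgebra (r s : ℂˣ) : HopfAlgebra ℂ (BorelG2 r s) where
  antipode := antipodeMap r s
  mul_antipode_rTensor_comul := LinearMap.ext fun x => mulLeftAntipode_comulHom x
  mul_antipode_lTensor_comul := LinearMap.ext fun x => mulRightAntipode_comulHom x

/-! The structure maps on the generators -/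

theorem comul_e₁ : Coalgebra.comul (R := ℂ) (e₁ r s) = e₁ r s ⊗ₜ[ℂ] (1 : BorelG2 r s) +
    ((k₁ r s ^ 2 * (k₂ r s)⁻¹ : (BorelG2 r s)ˣ) : BorelG2 r s) ⊗ₜ[ℂ] e₁ r s := comulHom_e₁

theorem comul_e₂ : Coalgebra.comul (R := ℂ) (e₂ r s) = e₂ r s ⊗ₜ[ℂ] (1 : BorelG2 r s) +
    (((k₁ r s)⁻¹ ^ 3 * k₂ r s ^ 2 : (BorelG2 r s)ˣ) : BorelG2 r s) ⊗ₜ[ℂ] e₂ r s := comulHom_e₂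

theorem comul_k₁ : Coalgebra.comul (R := ℂ) (k₁ r s : BorelG2 r s) =
    (k₁ r s : BorelG2 r s) ⊗ₜ[ℂ] (k₁ r s : BorelG2 r s) := comulHom_k₁

theorem comul_k₂ : Coalgebra.comul (R := ℂ) (k₂ r s : BorelG2 r s) =
    (k₂ r s : BorelG2 r s) ⊗ₜ[ℂ] (k₂ r s : BorelG2 r s) := comulHom_k₂

theorem counit_e₁ : Coalgebra.counit (R := ℂ) (e₁ r s) = 0 := counitHom_e₁

theorem counit_e₂ : Coalgebra.counit (R := ℂ) (e₂ r s) = 0 := counitHom_e₂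

theorem counit_k₁ : Coalgebra.counit (R := ℂ) (k₁ r s : BorelG2 r s) = 1 := counitHom_k₁

theorem counit_k₂ : Coalgebra.counit (R := ℂ) (k₂ r s : BorelG2 r s) = 1 := counitHom_k₂

theorem antipode_e₁ : HopfAlgebra.antipode ℂ (e₁ r s) =
    -(((k₁ r s ^ 2 * (k₂ r s)⁻¹)⁻¹ : (BorelG2 r s)ˣ) * e₁ r s) := antipodeMap_e₁

theorem antipode_e₂ : HopfAlgebra.antipode ℂ (e₂ r s) =
    -((((k₁ r s)⁻¹ ^ 3 * k₂ r s ^ 2)⁻¹ : (BorelG2 r s)ˣ) * e₂ r s) := antipodeMap_e₂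

theorem antipode_k₁ : HopfAlgebra.antipode ℂ (k₁ r s : BorelG2 r s) =
    ((k₁ r s)⁻¹ : (BorelG2 r s)ˣ) := antipodeMap_k₁

theorem antipode_k₂ : HopfAlgebra.antipode ℂ (k₂ r s : BorelG2 r s) =
    ((k₂ r s)⁻¹ : (BorelG2 r s)ˣ) := antipodeMap_k₂

end BorelG2

/-- The group of Hopf algebra automorphisms of `A`: the algebra automorphisms that commute with
comultiplication, counit and antipode. -/
def hopfAut (R A : Type*) [CommRing R] [Ring A] [HopfAlgebra R A] : Subgroup (A ≃ₐ[R] A) where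
  carrier := {θ |
    (∀ x, Coalgebra.comul (R := R) (θ x) =
      TensorProduct.map θ.toLinearMap θ.toLinearMap (Coalgebra.comul (R := R) x)) ∧
    (∀ x, Coalgebra.counit (R := R) (θ x) = Coalgebra.counit (R := R) x) ∧
    (∀ x, HopfAlgebra.antipode R (θ x) = θ (HopfAlgebra.antipode R x))}
  one_mem' := by
    refine ⟨fun x => ?_, fun x => rfl, fun x => rfl⟩
    have h : (1 : A ≃ₐ[R] A).toLinearMap = LinearMap.id := rfl
    rw [h, TensorProduct.map_id]
    rfl
  mul_mem' := by
    rintro θ η ⟨h₁, h₂, h₃⟩ ⟨h₁', h₂', h₃'⟩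
    refine ⟨fun x => ?_, fun x => ?_, fun x => ?_⟩
    · have h : (θ * η).toLinearMap = θ.toLinearMap ∘ₗ η.toLinearMap := rfl
      rw [h, TensorProduct.map_comp, AlgEquiv.mul_apply, h₁, h₁']
      rfl
    · rw [AlgEquiv.mul_apply, h₂, h₂']
    · rw [AlgEquiv.mul_apply, h₃, h₃', AlgEquiv.mul_apply]
  inv_mem' := by
    rintro θ ⟨h₁, h₂, h₃⟩
    have hθ : ∀ x, θ (θ⁻¹ x) = x := fun x => θ.apply_symm_apply x
    have hθ' : ∀ x, θ⁻¹ (θ x) = x := fun x => θ.symm_apply_apply x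
    refine ⟨fun x => ?_, fun x => ?_, fun x => ?_⟩
    · have h : (θ⁻¹).toLinearMap ∘ₗ θ.toLinearMap = LinearMap.id := LinearMap.ext hθ'
      have h' := congrArg (TensorProduct.map (θ⁻¹).toLinearMap (θ⁻¹).toLinearMap) (h₁ (θ⁻¹ x))
      rw [hθ, ← LinearMap.comp_apply (TensorProduct.map _ _) (TensorProduct.map _ _),
        ← TensorProduct.map_comp, h, TensorProduct.map_id] at h'
      exact h'.symm
    · rw [← h₂, hθ]
    · rw [← hθ' (HopfAlgebra.antipode R _), ← h₃, hθ]

end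

/-! Conjugation by `k₁` multiplies a word with `a` letters `e₁` and `b` letters `e₂` by r^(-a+3b)
s^(-2a+3b). These weights are distinct because r and s are multiplicatively independent, so the
spans of monomials of a given degree are exactly eigenspaces of one operator. This yields an
ℕ²-grading without a PBW basis: the monomials span and eigenspaces are independent
(`eigenspace_eq_component`).

Group-like elements lie in the torus (`exists_eq_torus`). The conjugates of a group-like g by powers
of `k₁` are group-like and lie in a finite-dimensional space. Distinct group-like elements are
linearly independent, so a positive power of `k₁` fixes g. Hence g has degree 0, is a combination of
the elements k₁ᵐk₂ⁿ, and by independence is one of them.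

A Hopf automorphism θ therefore sends torus elements to torus elements, so each θ(eₗ) is an
eigenvector of conjugation by `k₁` and hence homogeneous (`exists_apply_mem_component`). The degrees
of θ(e₁) and θ(e₂) generate ℕ² because θ is invertible, so they are the two unit vectors in some
order (`apply_mem_component_or`). In such a degree the skew-primitivity of θ(eₗ) makes it a multiple
of a generator and determines θ(wₗ) (`exists_eq_smul_of_comul`), where w₁ = k₁²k₂⁻¹ and w₂ =
k₁⁻³k₂².

An interchange of the generators would identify the scalars rs⁻¹ and r³s⁻³ by which w₁, e₁ and w₂,
e₂ commute, which independence forbids. So θ fixes w₁ and w₂, which generate the torus. Conversely,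
the relations and the structure maps are compatible with arbitrary rescaling of e₁ and e₂. -/

noncomputable section

/-! ### Conjugation by units, and independent families of submodules -/

/-- Conjugation by a unit, as a linear map. -/
def conjLinear {B : Type*} [Ring B] [Algebra ℂ B] (u : Bˣ) : B →ₗ[ℂ] B :=
  LinearMap.mulRight ℂ ((u⁻¹ : Bˣ) : B) ∘ₗ LinearMap.mulLeft ℂ (u : B)

section Conj

variable {B : Type*} [Ring B] [Algebra ℂ B]

theorem conjLinear_apply (u : Bˣ) (x : B) : conjLinear u x = u * x * (u⁻¹ : Bˣ) := rfl

theorem conjLinear_mul_apply (u v : Bˣ) (x : B) :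
    conjLinear (u * v) x = conjLinear u (conjLinear v x) := by
  simp [conjLinear_apply, mul_assoc]

theorem conjLinear_apply_mul (u : Bˣ) (x y : B) :
    conjLinear u (x * y) = conjLinear u x * conjLinear u y := by
  simp [conjLinear_apply, mul_assoc]

theorem conjLinear_eq_smul_iff {u : Bˣ} {x : B} {c : ℂ} :
    conjLinear u x = c • x ↔ (u : B) * x = c • (x * u) := by
  rw [conjLinear_apply, Units.mul_inv_eq_iff_eq_mul, smul_mul_assoc]

theorem conjLinear_injective (u : Bˣ) : Function.Injective (conjLinear u) := fun x y h => by
  simpa [conjLinear_apply] using h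

/-- The units that fix the line spanned by `x` under conjugation. -/
def conjStabilizer (x : B) : Subgroup Bˣ where
  carrier := {u | ∃ c : ℂˣ, conjLinear u x = (c : ℂ) • x}
  one_mem' := ⟨1, by simp [conjLinear_apply]⟩
  mul_mem' := by
    rintro u v ⟨c, hc⟩ ⟨d, hd⟩
    exact ⟨d * c, by rw [conjLinear_mul_apply, hd, map_smul, hc, smul_smul, Units.val_mul]⟩
  inv_mem' := by
    rintro u ⟨c, hc⟩
    refine ⟨c⁻¹, conjLinear_injective u ?_⟩
    rw [← conjLinear_mul_apply, mul_inv_cancel, map_smul, hc, smul_smul, Units.inv_mul, one_smul]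
    simp [conjLinear_apply]

end Conj

/-- A family of submodules that spans, and is contained termwise in an independent family, is equal
to the independent family. -/
theorem iSupIndep.eq_of_le_of_iSup_eq_top {ι R M : Type*} [Ring R] [AddCommGroup M] [Module R M]
    {A E : ι → Submodule R M} (hE : iSupIndep E) (hle : ∀ i, A i ≤ E i) (hA : ⨆ i, A i = ⊤)
    (i : ι) : E i = A i := by
  have h1 : A i ⊔ ⨆ (j) (_ : j ≠ i), A j = ⊤ := by
    rw [← hA, eq_comm]
    refine le_antisymm (iSup_le fun j => ?_) (sup_le (le_iSup _ i) (iSup₂_le fun j _ => le_iSup _ j))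
    by_cases h : j = i
    · exact h ▸ le_sup_left
    · exact le_sup_of_le_right (le_iSup₂_of_le j h le_rfl)
  have h2 : (⨆ (j) (_ : j ≠ i), A j) ⊓ E i = ⊥ :=
    ((hE i).symm.mono_left (iSup₂_mono fun j _ => hle j)).eq_bot
  -- Modular law, valid since `A i ≤ E i`: with B the supremum of the other `A j`, (A i ⊔ B) ⊓ E i =
  -- A i ⊔ (B ⊓ E i).
  have h3 := sup_inf_assoc_of_le (⨆ (j) (_ : j ≠ i), A j) (hle i)
  rwa [h1, top_inf_eq, h2, sup_bot_eq] at h3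

/-! ### The ℕ²-grading by eigenspaces of conjugation by `k₁` -/

namespace BorelG2

variable {r s : ℂˣ}

/-- The group-like element `k₁ᵐk₂ⁿ`. -/
def torus (r s : ℂˣ) (m n : ℤ) : (BorelG2 r s)ˣ := k₁ r s ^ m * k₂ r s ^ n

theorem torus_mul (m n m' n' : ℤ) :
    torus r s m n * torus r s m' n' = torus r s (m + m') (n + n') := by
  have h := (sat r s).commute
  rw [torus, torus, torus, zpow_add, zpow_add, mul_assoc, mul_assoc, ← mul_assoc (k₂ r s ^ n),
    ← (h.zpow_zpow m' n).eq, mul_assoc]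

theorem torus_zero : torus r s 0 0 = 1 := by simp [torus]

theorem torus_inv (m n : ℤ) : (torus r s m n)⁻¹ = torus r s (-m) (-n) := by
  rw [inv_eq_iff_mul_eq_one, torus_mul, add_neg_cancel, add_neg_cancel, torus_zero]

theorem torus_one_zero : torus r s 1 0 = k₁ r s := by simp [torus]

theorem torus_zero_one : torus r s 0 1 = k₂ r s := by simp [torus]

theorem torus_w₁ : torus r s 2 (-1) = w₁ r s := by
  simp [torus, w₁, wUnit₁, zpow_ofNat]

theorem torus_w₂ : torus r s (-3) 2 = w₂ r s := by
  simp only [torus, w₂, wUnit₂, inv_pow, zpow_neg]; rfl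

/-- Monomials `wk₁ᵐk₂ⁿ` with `w` a word in `e₁, e₂` with `a` letters `e₁` and `b` letters `e₂`. -/
inductive IsMonomial (r s : ℂˣ) : ℕ × ℕ → BorelG2 r s → Prop
  | torus (m n : ℤ) : IsMonomial r s (0, 0) (torus r s m n)
  | e₁_mul {a b : ℕ} {x : BorelG2 r s} (h : IsMonomial r s (a, b) x) :
      IsMonomial r s (a + 1, b) (e₁ r s * x)
  | e₂_mul {a b : ℕ} {x : BorelG2 r s} (h : IsMonomial r s (a, b) x) :
      IsMonomial r s (a, b + 1) (e₂ r s * x)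

theorem IsMonomial.exists_of_zero {x : BorelG2 r s} (h : IsMonomial r s (0, 0) x) :
    ∃ m n, x = BorelG2.torus r s m n := by
  cases h with
  | torus m n => exact ⟨m, n, rfl⟩

theorem IsMonomial.exists_of_one_zero {x : BorelG2 r s} (h : IsMonomial r s (1, 0) x) :
    ∃ m n, x = BorelG2.e₁ r s * BorelG2.torus r s m n := by
  cases h with
  | e₁_mul h =>
    obtain ⟨m, n, rfl⟩ := h.exists_of_zero
    exact ⟨m, n, rfl⟩

theorem IsMonomial.exists_of_zero_one {x : BorelG2 r s} (h : IsMonomial r s (0, 1) x) :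
    ∃ m n, x = BorelG2.e₂ r s * BorelG2.torus r s m n := by
  cases h with
  | e₂_mul h =>
    obtain ⟨m, n, rfl⟩ := h.exists_of_zero
    exact ⟨m, n, rfl⟩

/-- The component of degree `(a, b)`. -/
def component (r s : ℂˣ) (p : ℕ × ℕ) : Submodule ℂ (BorelG2 r s) :=
  Submodule.span ℂ {x | IsMonomial r s p x}

/-- The conjugation weight of `k₁` in degree `(a, b)`. -/
def weight (r s : ℂˣ) (p : ℕ × ℕ) : ℂˣ :=
  r ^ (-(p.1 : ℤ) + 3 * p.2) * s ^ (-2 * (p.1 : ℤ) + 3 * p.2)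

theorem weight_zero : weight r s (0, 0) = 1 := by simp [weight]

theorem weight_add (p q : ℕ × ℕ) : weight r s (p + q) = weight r s p * weight r s q := by
  simp only [weight, Prod.fst_add, Prod.snd_add, Nat.cast_add]
  rw [mul_mul_mul_comm, ← zpow_add, ← zpow_add]
  congr 2 <;> ring

/-- The exponent vectors (-1, -2) and (3, 3) of the weights of e₁ and e₂ have determinant 3 ≠ 0, so
the degree can be recovered from the exponents of r and s. A general positive power `N` is allowed
because the study of group-like elements only provides a power of `k₁` that fixes them. -/
theorem weight_pow_injective (hrs : ∀ m n : ℤ, r ^ m * s ^ n = 1 → m = 0 ∧ n = 0) {N : ℕ}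
    (hN : 0 < N) : Function.Injective fun p : ℕ × ℕ => ((weight r s p ^ N : ℂˣ) : ℂ) := by
  intro p q h
  have h1 : weight r s p ^ N = weight r s q ^ N := Units.ext h
  have h2 : r ^ ((-(p.1 : ℤ) + 3 * p.2 - (-(q.1 : ℤ) + 3 * q.2)) * N) *
      s ^ ((-2 * (p.1 : ℤ) + 3 * p.2 - (-2 * (q.1 : ℤ) + 3 * q.2)) * N) = 1 := by
    rw [zpow_mul, zpow_mul, zpow_natCast, zpow_natCast, ← mul_pow, zpow_sub, zpow_sub,
      mul_mul_mul_comm, ← mul_inv]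
    change (weight r s p * (weight r s q)⁻¹) ^ N = 1
    rw [mul_pow, h1, inv_pow, mul_inv_cancel]
  obtain ⟨h3, h4⟩ := hrs _ _ h2
  have hN' : (N : ℤ) ≠ 0 := by positivity
  have h5 := (mul_eq_zero.1 h3).resolve_right hN'
  have h6 := (mul_eq_zero.1 h4).resolve_right hN'
  ext <;> omega

theorem conj_k₁_e₁ : conjLinear (k₁ r s) (e₁ r s) = (weight r s (1, 0) : ℂ) • e₁ r s := by
  rw [conjLinear_eq_smul_iff, (sat r s).k₁_e₁]
  simp [weight]

theorem conj_k₁_e₂ : conjLinear (k₁ r s) (e₂ r s) = (weight r s (0, 1) : ℂ) • e₂ r s := by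
  rw [conjLinear_eq_smul_iff, (sat r s).k₁_e₂]
  simp [weight]

/-- Both `k₁` and `k₂` lie in the subgroup stabilizing the line of `e₁`. Only the existence of the
scalar is needed later. -/
theorem exists_conj_torus_e₁ (m n : ℤ) :
    ∃ c : ℂˣ, conjLinear (torus r s m n) (e₁ r s) = (c : ℂ) • e₁ r s := by
  have h1 : k₁ r s ∈ conjStabilizer (e₁ r s) := ⟨_, conj_k₁_e₁⟩
  have h2 : k₂ r s ∈ conjStabilizer (e₁ r s) :=
    ⟨r⁻¹ ^ 3 * s⁻¹ ^ 3, conjLinear_eq_smul_iff.2 (by simpa using (sat r s).k₂_e₁)⟩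
  exact mul_mem (zpow_mem h1 m) (zpow_mem h2 n)

theorem exists_conj_torus_e₂ (m n : ℤ) :
    ∃ c : ℂˣ, conjLinear (torus r s m n) (e₂ r s) = (c : ℂ) • e₂ r s := by
  have h1 : k₁ r s ∈ conjStabilizer (e₂ r s) := ⟨_, conj_k₁_e₂⟩
  have h2 : k₂ r s ∈ conjStabilizer (e₂ r s) :=
    ⟨r ^ 6 * s ^ 3, conjLinear_eq_smul_iff.2 (by simpa using (sat r s).k₂_e₂)⟩
  exact mul_mem (zpow_mem h1 m) (zpow_mem h2 n)

theorem conj_torus_torus (m n m' n' : ℤ) :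
    conjLinear (torus r s m n) (torus r s m' n') = (torus r s m' n' : BorelG2 r s) := by
  rw [conjLinear_apply, Units.mul_inv_eq_iff_eq_mul, ← Units.val_mul, ← Units.val_mul, torus_mul,
    torus_mul, add_comm m, add_comm n]

/-- The component of degree `p` as an eigenspace. -/
theorem component_le_eigenspace (p : ℕ × ℕ) (N : ℕ) :
    component r s p ≤
      Module.End.eigenspace (conjLinear (k₁ r s ^ N)) ((weight r s p ^ N : ℂˣ) : ℂ) := by
  refine Submodule.span_le.2 fun x hx => ?_
  have h1 : conjLinear (k₁ r s) x = (weight r s p : ℂ) • x := by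
    induction hx with
    | torus m n =>
      rw [weight_zero, ← torus_one_zero, conj_torus_torus, Units.val_one, one_smul]
    | @e₁_mul a b x h ih =>
      rw [conjLinear_apply_mul, ih, conj_k₁_e₁, smul_mul_smul_comm, ← Units.val_mul, ← weight_add,
        Prod.mk_add_mk, add_comm 1, zero_add]
    | @e₂_mul a b x h ih =>
      rw [conjLinear_apply_mul, ih, conj_k₁_e₂, smul_mul_smul_comm, ← Units.val_mul, ← weight_add,
        Prod.mk_add_mk, add_comm 1, zero_add]
  rw [SetLike.mem_coe, Module.End.mem_eigenspace_iff, conjLinear_eq_smul_iff]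
  simpa using qcomm_pow (conjLinear_eq_smul_iff.1 h1) N

/-- Torus elements pass each letter at the cost of a scalar, and are absorbed by the torus factor at
the end of the word. -/
theorem IsMonomial.torus_mul_mem (m n : ℤ) {p : ℕ × ℕ} {x : BorelG2 r s}
    (h : IsMonomial r s p x) : (BorelG2.torus r s m n : BorelG2 r s) * x ∈ component r s p := by
  induction h with
  | torus m' n' =>
    rw [← Units.val_mul, torus_mul]
    exact Submodule.subset_span (.torus _ _)
  | @e₁_mul a b x h ih =>
    obtain ⟨c, hc⟩ := exists_conj_torus_e₁ (r := r) (s := s) m n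
    rw [mul_mul_of_qcomm (conjLinear_eq_smul_iff.1 hc)]
    refine Submodule.smul_mem _ _ ?_
    have hle : component r s (a, b) ≤
        (component r s (a + 1, b)).comap (LinearMap.mulLeft ℂ (BorelG2.e₁ r s)) :=
      Submodule.span_le.2 fun y hy => Submodule.subset_span (IsMonomial.e₁_mul hy)
    exact hle ih
  | @e₂_mul a b x h ih =>
    obtain ⟨c, hc⟩ := exists_conj_torus_e₂ (r := r) (s := s) m n
    rw [mul_mul_of_qcomm (conjLinear_eq_smul_iff.1 hc)]
    refine Submodule.smul_mem _ _ ?_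
    have hle : component r s (a, b) ≤
        (component r s (a, b + 1)).comap (LinearMap.mulLeft ℂ (BorelG2.e₂ r s)) :=
      Submodule.span_le.2 fun y hy => Submodule.subset_span (IsMonomial.e₂_mul hy)
    exact hle ih

/-- The sum of the components is stable under left multiplication by every generator and contains 1,
so it is everything. -/
theorem iSup_component : ⨆ p, component r s p = ⊤ := by
  have hle (z : BorelG2 r s) (hz : ∀ p x, IsMonomial r s p x → z * x ∈ ⨆ p, component r s p) :
      ∀ y ∈ ⨆ p, component r s p, z * y ∈ ⨆ p, component r s p := by
    have : ⨆ p, component r s p ≤ (⨆ p, component r s p).comap (LinearMap.mulLeft ℂ z) :=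
      iSup_le fun p => Submodule.span_le.2 fun x hx => hz p x hx
    exact this
  have ht (m n : ℤ) : ∀ y ∈ ⨆ p, component r s p,
      (torus r s m n : BorelG2 r s) * y ∈ ⨆ p, component r s p :=
    hle _ fun p x hx => le_iSup (component r s) p (hx.torus_mul_mem m n)
  have hmul (z : BorelG2 r s) :
      ∀ y ∈ ⨆ p, component r s p, z * y ∈ ⨆ p, component r s p := by
    induction z using BorelG2.induction with
    | hc c =>
      intro y hy
      rw [← Algebra.smul_def]
      exact Submodule.smul_mem _ _ hy
    | he₁ =>
      exact hle _ fun p x hx => le_iSup (component r s) (p.1 + 1, p.2)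
        (Submodule.subset_span (IsMonomial.e₁_mul hx))
    | he₂ =>
      exact hle _ fun p x hx => le_iSup (component r s) (p.1, p.2 + 1)
        (Submodule.subset_span (IsMonomial.e₂_mul hx))
    | hk₁ => simpa only [torus_one_zero] using ht 1 0
    | hk₂ => simpa only [torus_zero_one] using ht 0 1
    -- The exponent -0 is the form that `torus_inv` produces.
    | hk₁i => simpa only [← torus_one_zero, torus_inv] using ht (-1) (-0)
    | hk₂i => simpa only [← torus_zero_one, torus_inv] using ht (-0) (-1)
    | hmul x y hx hy =>
      intro z hz
      rw [mul_assoc]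
      exact hx _ (hy _ hz)
    | hadd x y hx hy =>
      intro z hz
      rw [add_mul]
      exact add_mem (hx _ hz) (hy _ hz)
  refine eq_top_iff.2 fun x _ => ?_
  have h1 : (1 : BorelG2 r s) ∈ component r s (0, 0) := by
    rw [← Units.val_one, ← torus_zero]
    exact Submodule.subset_span (.torus 0 0)
  simpa using hmul x 1 (le_iSup (component r s) _ h1)

/-- The components lie in eigenspaces with distinct eigenvalues and together span, which leaves no
room for a larger eigenspace. Linear independence of monomials plays no role. -/
theorem eigenspace_eq_component (hrs : ∀ m n : ℤ, r ^ m * s ^ n = 1 → m = 0 ∧ n = 0) {N : ℕ}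
    (hN : 0 < N) (p : ℕ × ℕ) :
    Module.End.eigenspace (conjLinear (k₁ r s ^ N)) ((weight r s p ^ N : ℂˣ) : ℂ) =
      component r s p :=
  ((Module.End.eigenspaces_iSupIndep (conjLinear (k₁ r s ^ N))).comp
    (weight_pow_injective hrs hN)).eq_of_le_of_iSup_eq_top
      (fun p => component_le_eigenspace p N) iSup_component p

theorem mem_component_iff (hrs : ∀ m n : ℤ, r ^ m * s ^ n = 1 → m = 0 ∧ n = 0) {p : ℕ × ℕ}
    {x : BorelG2 r s} :
    x ∈ component r s p ↔ conjLinear (k₁ r s) x = (weight r s p : ℂ) • x := by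
  rw [← eigenspace_eq_component hrs one_pos, Module.End.mem_eigenspace_iff, pow_one, pow_one]

/-- A nonzero eigenvector of conjugation by `k₁` is homogeneous. -/
theorem exists_mem_component (hrs : ∀ m n : ℤ, r ^ m * s ^ n = 1 → m = 0 ∧ n = 0)
    {x : BorelG2 r s} (hx : x ≠ 0) {c : ℂ} (h : conjLinear (k₁ r s) x = c • x) :
    ∃ p, x ∈ component r s p := by
  by_cases hc : ∃ p, (weight r s p : ℂ) = c
  · obtain ⟨p, rfl⟩ := hc
    exact ⟨p, (mem_component_iff hrs).2 h⟩
  · push Not at hc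
    -- If `c` is not a weight, the eigenspaces for the other eigenvalues already span, so
    -- independence makes the eigenspace of `c` zero.
    have h1 : ⨆ p, component r s p ≤
        ⨆ (d) (_ : d ≠ c), Module.End.eigenspace (conjLinear (k₁ r s)) d := by
      refine iSup_le fun p => le_iSup₂_of_le _ (hc p) fun y hy => ?_
      exact Module.End.mem_eigenspace_iff.2 ((mem_component_iff hrs).1 hy)
    rw [iSup_component] at h1
    have h2 := (Module.End.eigenspaces_iSupIndep (conjLinear (k₁ r s)) c).mono_right h1
    rw [disjoint_top] at h2
    exact absurd ((Submodule.mem_bot ℂ).1 (h2 ▸ Module.End.mem_eigenspace_iff.2 h)) hx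

/-! ### Local finiteness and group-like elements -/

/-- Every element is contained in a finite-dimensional subspace stable under conjugation by
`k₁`. -/
theorem exists_finiteDimensional_stable (x : BorelG2 r s) :
    ∃ W : Submodule ℂ (BorelG2 r s), FiniteDimensional ℂ W ∧
      (∀ y ∈ W, conjLinear (k₁ r s) y ∈ W) ∧ x ∈ W := by
  have hx : x ∈ Submodule.span ℂ (⋃ p, {x | IsMonomial r s p x}) := by
    rw [Submodule.span_iUnion]
    exact (iSup_component (r := r) (s := s)).symm ▸ Submodule.mem_top
  induction hx using Submodule.span_induction with
  | zero => exact ⟨⊥, inferInstance, by simp, zero_mem _⟩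
  | add y z _ _ hy hz =>
    obtain ⟨V, _, hV, hyV⟩ := hy
    obtain ⟨W, _, hW, hzW⟩ := hz
    refine ⟨V ⊔ W, inferInstance, ?_, Submodule.add_mem_sup hyV hzW⟩
    intro u hu
    obtain ⟨v, hv, w, hw, rfl⟩ := Submodule.mem_sup.1 hu
    rw [map_add]
    exact Submodule.add_mem_sup (hV v hv) (hW w hw)
  | smul c y _ hy =>
    obtain ⟨V, hV', hV, hyV⟩ := hy
    exact ⟨V, hV', hV, V.smul_mem c hyV⟩
  | mem y hy =>
    obtain ⟨p, hp⟩ := Set.mem_iUnion.1 hy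
    have h1 := component_le_eigenspace p 1 (Submodule.subset_span hp)
    rw [pow_one, pow_one, Module.End.mem_eigenspace_iff] at h1
    refine ⟨Submodule.span ℂ {y}, inferInstance, fun z hz => ?_, Submodule.mem_span_singleton_self y⟩
    obtain ⟨c, rfl⟩ := Submodule.mem_span_singleton.1 hz
    rw [map_smul, h1]
    exact Submodule.smul_mem _ _ (Submodule.smul_mem _ _ (Submodule.mem_span_singleton_self y))

theorem isGroupLikeElem_k₁ : IsGroupLikeElem ℂ (k₁ r s : BorelG2 r s) := ⟨counit_k₁, comul_k₁⟩

theorem isGroupLikeElem_k₂ : IsGroupLikeElem ℂ (k₂ r s : BorelG2 r s) := ⟨counit_k₂, comul_k₂⟩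

/-- The subgroup of group-like units. -/
def groupLikeUnits (r s : ℂˣ) : Subgroup (BorelG2 r s)ˣ where
  carrier := {u | IsGroupLikeElem ℂ (u : BorelG2 r s)}
  one_mem' := IsGroupLikeElem.one
  mul_mem' := IsGroupLikeElem.mul
  inv_mem' := isGroupLikeElem_unitsInv.2

theorem isGroupLikeElem_torus (m n : ℤ) : IsGroupLikeElem ℂ (torus r s m n : BorelG2 r s) :=
  have h1 : k₁ r s ∈ groupLikeUnits r s := isGroupLikeElem_k₁
  have h2 : k₂ r s ∈ groupLikeUnits r s := isGroupLikeElem_k₂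
  mul_mem (zpow_mem h1 m) (zpow_mem h2 n)

/-- The group-like elements are the `k₁ᵐk₂ⁿ`. -/
theorem exists_eq_torus (hrs : ∀ m n : ℤ, r ^ m * s ^ n = 1 → m = 0 ∧ n = 0)
    {g : BorelG2 r s} (hg : IsGroupLikeElem ℂ g) : ∃ m n, g = torus r s m n := by
  obtain ⟨W, _, hW, hgW⟩ := exists_finiteDimensional_stable g
  have h1 (N : ℕ) : conjLinear (k₁ r s ^ N) g ∈ W := by
    induction N with
    | zero => simpa [conjLinear_apply]
    | succ N ih => rw [pow_succ', conjLinear_mul_apply]; exact hW _ ih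
  have h2 (N : ℕ) : IsGroupLikeElem ℂ (conjLinear (k₁ r s ^ N) g) := by
    have h := isGroupLikeElem_torus (r := r) (s := s) N 0
    have h' := isGroupLikeElem_torus (r := r) (s := s) (-N) 0
    have e : torus r s N 0 = k₁ r s ^ N := by simp [torus]
    have e' : torus r s (-N) 0 = (k₁ r s ^ N)⁻¹ := by simp [torus]
    rw [e] at h
    rw [e'] at h'
    exact (h.mul hg).mul h'
  -- If these conjugates were pairwise distinct, they would be an infinite linearly independent
  -- family in the finite-dimensional space `W`.
  have h3 : ¬ Function.Injective fun N : ℕ => conjLinear (k₁ r s ^ N) g := by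
    intro hinj
    have hli : LinearIndependent ℂ fun N : ℕ => conjLinear (k₁ r s ^ N) g :=
      (linearIndepOn_isGroupLikeElem (R := ℂ) (A := BorelG2 r s)).comp
        (fun N : ℕ => (⟨conjLinear (k₁ r s ^ N) g, h2 N⟩ : {a | IsGroupLikeElem ℂ a}))
        fun i j hij => hinj (congrArg Subtype.val hij)
    have hli' : LinearIndependent ℂ fun N : ℕ => (⟨conjLinear (k₁ r s ^ N) g, h1 N⟩ : W) :=
      LinearIndependent.of_comp W.subtype hli
    exact not_finite_iff_infinite.2 (inferInstanceAs (Infinite ℕ)) hli'.finite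
  obtain ⟨i, j, hij, hlt⟩ : ∃ i j, conjLinear (k₁ r s ^ i) g = conjLinear (k₁ r s ^ j) g ∧ i < j := by
    simp only [Function.Injective, not_forall] at h3
    obtain ⟨i, j, h, hne⟩ := h3
    rcases lt_or_gt_of_ne hne with h' | h'
    · exact ⟨i, j, h, h'⟩
    · exact ⟨j, i, h.symm, h'⟩
  -- Here j = i + N + 1, so the power of `k₁` that fixes `g` is the positive number N + 1.
  obtain ⟨N, rfl⟩ := Nat.exists_eq_add_of_lt hlt
  have h4 : conjLinear (k₁ r s ^ (N + 1)) g = g := by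
    rw [add_assoc, pow_add, conjLinear_mul_apply] at hij
    exact (conjLinear_injective _ hij).symm
  have h5 : g ∈ component r s (0, 0) := by
    rw [← eigenspace_eq_component hrs N.succ_pos, Module.End.mem_eigenspace_iff, h4, weight_zero]
    simp
  have h6 : g ∈ Submodule.span ℂ {x | ∃ m n, x = (torus r s m n : BorelG2 r s)} :=
    Submodule.span_mono (fun x hx => hx.exists_of_zero) h5
  -- All elements of the enlarged set are group-like, hence independent; an element of the span of
  -- the torus elements must then be one of them.
  have h7 : LinearIndepOn ℂ id (insert g {x | ∃ m n, x = (torus r s m n : BorelG2 r s)}) := by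
    refine (linearIndepOn_isGroupLikeElem (R := ℂ) (A := BorelG2 r s)).mono ?_
    rintro x (rfl | ⟨m, n, rfl⟩)
    · exact hg
    · exact isGroupLikeElem_torus m n
  exact (linearIndepOn_id_insert_iff.1 h7).2 h6

end BorelG2

/-! ### Nonvanishing of the generators -/

/-- The invertible matrix `diag(c, 1)`. -/
def diagUnit (c : ℂˣ) : (Matrix (Fin 2) (Fin 2) ℂ)ˣ where
  val := !![(c : ℂ), 0; 0, 1]
  inv := !![((c⁻¹ : ℂˣ) : ℂ), 0; 0, 1]
  val_inv := by simp [Matrix.one_fin_two]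
  inv_val := by simp [Matrix.one_fin_two]

namespace BorelG2

variable {r s : ℂˣ}

theorem diagUnit_mul_nilpotent (c : ℂˣ) :
    (diagUnit c : Matrix (Fin 2) (Fin 2) ℂ) * !![0, 1; 0, 0] =
      (c : ℂ) • (!![0, 1; 0, 0] * (diagUnit c : Matrix (Fin 2) (Fin 2) ℂ)) := by
  simp [diagUnit]

theorem diagUnit_mul_comm (c d : ℂˣ) :
    (diagUnit c : Matrix (Fin 2) (Fin 2) ℂ) * diagUnit d = diagUnit d * diagUnit c := by
  simp [diagUnit, mul_comm]

/-- A two-dimensional representation that detects `e₁`: every term of both Serre relations contains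
the generator that is sent to 0. -/
theorem sat_diag_e₁ (r s : ℂˣ) : BorelG2Sat r s (!![0, 1; 0, 0] : Matrix (Fin 2) (Fin 2) ℂ) 0
    (diagUnit (r⁻¹ * s⁻¹ ^ 2)) (diagUnit (r⁻¹ ^ 3 * s⁻¹ ^ 3)) where
  k₁_k₂ := diagUnit_mul_comm _ _
  k₁_e₁ := by rw [diagUnit_mul_nilpotent]; simp
  k₁_e₂ := by simp
  k₂_e₁ := by rw [diagUnit_mul_nilpotent]; simp
  k₂_e₂ := by simp
  serre₂ := by simp [serreQuadratic]
  serre₄ := by simp [serreQuartic]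

theorem sat_diag_e₂ (r s : ℂˣ) : BorelG2Sat r s 0 (!![0, 1; 0, 0] : Matrix (Fin 2) (Fin 2) ℂ)
    (diagUnit (r ^ 3 * s ^ 3)) (diagUnit (r ^ 6 * s ^ 3)) where
  k₁_k₂ := diagUnit_mul_comm _ _
  k₁_e₁ := by simp
  k₁_e₂ := by rw [diagUnit_mul_nilpotent]; simp
  k₂_e₁ := by simp
  k₂_e₂ := by rw [diagUnit_mul_nilpotent]; simp
  serre₂ := by simp [serreQuadratic]
  serre₄ := by simp [serreQuartic]

theorem e₁_ne_zero (r s : ℂˣ) : e₁ r s ≠ 0 := fun h => by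
  have h1 := congrArg (lift (sat_diag_e₁ r s)) h
  rw [lift_e₁, map_zero] at h1
  simpa using congrFun (congrFun h1 0) 1

theorem e₂_ne_zero (r s : ℂˣ) : e₂ r s ≠ 0 := fun h => by
  have h1 := congrArg (lift (sat_diag_e₂ r s)) h
  rw [lift_e₂, map_zero] at h1
  simpa using congrFun (congrFun h1 0) 1

/-! ### Projection to the torus and skew-primitive elements -/

/-- The monomials of the Laurent polynomial algebra `ℂ[ℤ²]`, as units. -/
def laurentUnit : Multiplicative (ℤ × ℤ) →* (AddMonoidAlgebra ℂ (ℤ × ℤ))ˣ :=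
  (Units.map (AddMonoidAlgebra.of ℂ (ℤ × ℤ))).comp toUnits.toMonoidHom

theorem sat_laurent (r s : ℂˣ) : BorelG2Sat r s (0 : AddMonoidAlgebra ℂ (ℤ × ℤ)) 0
    (laurentUnit (.ofAdd (1, 0))) (laurentUnit (.ofAdd (0, 1))) := by
  constructor <;> simp [serreQuadratic, serreQuartic, mul_comm]

/-- The projection to the torus part, which kills `e₁` and `e₂`. -/
def torusProj (r s : ℂˣ) : BorelG2 r s →ₐ[ℂ] AddMonoidAlgebra ℂ (ℤ × ℤ) := lift (sat_laurent r s)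

theorem torusProj_torus (m n : ℤ) :
    torusProj r s (torus r s m n) = AddMonoidAlgebra.single (m, n) 1 := by
  have h : Units.map (torusProj r s : BorelG2 r s →* _) (torus r s m n) =
      laurentUnit (.ofAdd (m, n)) := by
    have h1 : (Multiplicative.ofAdd (m, n) : Multiplicative (ℤ × ℤ)) =
        Multiplicative.ofAdd (1, 0) ^ m * Multiplicative.ofAdd (0, 1) ^ n := by
      rw [← ofAdd_zsmul, ← ofAdd_zsmul, ← ofAdd_add]
      simp
    rw [torus, map_mul, map_zpow, map_zpow, torusProj, map_lift_k₁, map_lift_k₂, h1, map_mul,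
      map_zpow, map_zpow]
  exact congrArg Units.val h

/-- The coefficient of `1` in the torus part. -/
def coeffOne (r s : ℂˣ) : BorelG2 r s →ₗ[ℂ] ℂ :=
  Finsupp.lapply 0 ∘ₗ (AddMonoidAlgebra.coeffLinearEquiv ℂ).toLinearMap ∘ₗ
    (torusProj r s).toLinearMap

theorem coeffOne_torus (m n : ℤ) :
    coeffOne r s (torus r s m n) = if m = 0 ∧ n = 0 then 1 else 0 := by
  have h : coeffOne r s (torus r s m n) = (torusProj r s (torus r s m n)).coeff 0 := rfl
  rw [h, torusProj_torus, AddMonoidAlgebra.coeff_single, Finsupp.single_apply]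
  simp [Prod.ext_iff]

theorem coeffOne_mul {e : BorelG2 r s} (he : torusProj r s e = 0) (x : BorelG2 r s) :
    coeffOne r s (e * x) = 0 := by
  have h : coeffOne r s (e * x) = (torusProj r s (e * x)).coeff 0 := rfl
  rw [h, map_mul, he, zero_mul]
  rfl

/-- A nonzero element of `eℂ[G]` that is `(1, h)`-primitive is a multiple of `e`, for
`(1, w)`-primitive `e`. -/
theorem exists_eq_smul_of_comul {e x h : BorelG2 r s} {w : BorelG2 r s}
    (he : Coalgebra.comul (R := ℂ) e = e ⊗ₜ[ℂ] 1 + w ⊗ₜ[ℂ] e) (hpi : torusProj r s e = 0)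
    (hx : x ∈ Submodule.span ℂ {x | ∃ m n, x = e * torus r s m n}) (hx0 : x ≠ 0)
    (hcomul : Coalgebra.comul (R := ℂ) x = x ⊗ₜ[ℂ] 1 + h ⊗ₜ[ℂ] x) :
    (∃ c : ℂˣ, x = (c : ℂ) • e) ∧ h = w := by
  -- The map (id ⊗ `coeffOne`) ∘ Δ. For a torus element t, Δ(et) = et ⊗ t + wt ⊗ et, so it keeps et
  -- when t has exponents (0, 0) and kills it otherwise. It also fixes `x`, by `hcomul` and
  -- `coeffOne` x = 0. So `x` is a multiple of `e`, without any independence of the elements et.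
  let R : BorelG2 r s →ₗ[ℂ] BorelG2 r s :=
    (TensorProduct.rid ℂ (BorelG2 r s)).toLinearMap ∘ₗ (coeffOne r s).lTensor (BorelG2 r s) ∘ₗ
      Coalgebra.comul
  have hone : coeffOne r s 1 = 1 := by
    rw [← Units.val_one, ← torus_zero, coeffOne_torus]; simp
  have hspan : Submodule.span ℂ {x | ∃ m n, x = e * torus r s m n} ≤
      ((Submodule.span ℂ {e}).comap R) ⊓ LinearMap.ker (coeffOne r s) := by
    refine Submodule.span_le.2 ?_
    rintro _ ⟨m, n, rfl⟩
    refine ⟨?_, coeffOne_mul hpi _⟩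
    have h1 : R (e * torus r s m n) =
        (if m = 0 ∧ n = 0 then (1 : ℂ) else 0) • (e * torus r s m n) := by
      simp [R, he, (isGroupLikeElem_torus m n).comul_eq_tmul_self, add_mul, coeffOne_mul hpi,
        coeffOne_torus]
    rw [SetLike.mem_coe, Submodule.mem_comap, h1]
    split_ifs with h2
    · rw [h2.1, h2.2, torus_zero, Units.val_one, mul_one]
      exact Submodule.smul_mem _ _ (Submodule.mem_span_singleton_self e)
    · rw [zero_smul]
      exact zero_mem _
  obtain ⟨h1, h2⟩ := hspan hx
  have h3 : R x = x := by
    simp [R, hcomul, hone, LinearMap.mem_ker.1 h2]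
  rw [SetLike.mem_coe, Submodule.mem_comap, h3] at h1
  obtain ⟨c, rfl⟩ := Submodule.mem_span_singleton.1 h1
  have hc : c ≠ 0 := fun h => hx0 (by rw [h, zero_smul])
  refine ⟨⟨Units.mk0 c hc, rfl⟩, ?_⟩
  rw [map_smul, he, smul_add, TensorProduct.smul_tmul', add_right_inj, ← TensorProduct.tmul_smul]
    at hcomul
  -- What remains is w ⊗ x = h ⊗ x; a functional with value 1 at the nonzero x cancels the second
  -- factor.
  obtain ⟨f, hf⟩ := Module.Projective.exists_dual_eq_one ℂ hx0
  rw [map_smul, smul_eq_mul] at hf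
  simpa [smul_smul, hf] using
    (congrArg (TensorProduct.rid ℂ (BorelG2 r s) ∘ f.lTensor (BorelG2 r s)) hcomul).symm

theorem torusProj_e₁ : torusProj r s (e₁ r s) = 0 := lift_e₁ _

theorem torusProj_e₂ : torusProj r s (e₂ r s) = 0 := lift_e₂ _

theorem exists_eq_smul_e₁ {x h : BorelG2 r s} (hx : x ∈ component r s (1, 0)) (hx0 : x ≠ 0)
    (hcomul : Coalgebra.comul (R := ℂ) x = x ⊗ₜ[ℂ] 1 + h ⊗ₜ[ℂ] x) :
    (∃ c : ℂˣ, x = (c : ℂ) • e₁ r s) ∧ h = w₁ r s :=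
  exists_eq_smul_of_comul comul_e₁ torusProj_e₁
    (Submodule.span_mono (fun _ hx => hx.exists_of_one_zero) hx) hx0 hcomul

theorem exists_eq_smul_e₂ {x h : BorelG2 r s} (hx : x ∈ component r s (0, 1)) (hx0 : x ≠ 0)
    (hcomul : Coalgebra.comul (R := ℂ) x = x ⊗ₜ[ℂ] 1 + h ⊗ₜ[ℂ] x) :
    (∃ c : ℂˣ, x = (c : ℂ) • e₂ r s) ∧ h = w₂ r s :=
  exists_eq_smul_of_comul comul_e₂ torusProj_e₂
    (Submodule.span_mono (fun _ hx => hx.exists_of_zero_one) hx) hx0 hcomul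

/-! ### Degrees under Hopf automorphisms -/

theorem mul_mem_component (hrs : ∀ m n : ℤ, r ^ m * s ^ n = 1 → m = 0 ∧ n = 0) {p q : ℕ × ℕ}
    {x y : BorelG2 r s} (hx : x ∈ component r s p) (hy : y ∈ component r s q) :
    x * y ∈ component r s (p + q) := by
  rw [mem_component_iff hrs] at hx hy ⊢
  rw [conjLinear_apply_mul, hx, hy, smul_mul_smul_comm, weight_add, Units.val_mul]

theorem degree_unique (hrs : ∀ m n : ℤ, r ^ m * s ^ n = 1 → m = 0 ∧ n = 0) {p q : ℕ × ℕ}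
    {x : BorelG2 r s} (hx0 : x ≠ 0) (hp : x ∈ component r s p) (hq : x ∈ component r s q) :
    p = q := by
  rw [mem_component_iff hrs] at hp hq
  apply weight_pow_injective hrs one_pos
  simpa using smul_left_injective ℂ hx0 (hp.symm.trans hq)

theorem e₁_mem_component (r s : ℂˣ) : e₁ r s ∈ component r s (1, 0) := by
  have h := (IsMonomial.torus (r := r) (s := s) 0 0).e₁_mul
  rw [torus_zero, Units.val_one, mul_one, zero_add] at h
  exact Submodule.subset_span h

theorem e₂_mem_component (r s : ℂˣ) : e₂ r s ∈ component r s (0, 1) := by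
  have h := (IsMonomial.torus (r := r) (s := s) 0 0).e₂_mul
  rw [torus_zero, Units.val_one, mul_one, zero_add] at h
  exact Submodule.subset_span h

section HopfAut

variable {θ : BorelG2 r s ≃ₐ[ℂ] BorelG2 r s}

theorem isGroupLikeElem_apply (hθ : θ ∈ hopfAut ℂ (BorelG2 r s)) {g : BorelG2 r s}
    (hg : IsGroupLikeElem ℂ g) : IsGroupLikeElem ℂ (θ g) where
  counit_eq_one := by rw [hθ.2.1, hg.counit_eq_one]
  comul_eq_tmul_self := by rw [hθ.1, hg.comul_eq_tmul_self]; rfl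

theorem exists_apply_torus (hrs : ∀ m n : ℤ, r ^ m * s ^ n = 1 → m = 0 ∧ n = 0)
    (hθ : θ ∈ hopfAut ℂ (BorelG2 r s)) (m n : ℤ) :
    ∃ m' n', θ (torus r s m n) = torus r s m' n' :=
  exists_eq_torus hrs (isGroupLikeElem_apply hθ (isGroupLikeElem_torus m n))

/-- The preimage of `k₁` under `θ` is a torus element, which scales `e`; applying `θ` shows that
`k₁` scales `θ e`. -/
theorem exists_apply_mem_component (hrs : ∀ m n : ℤ, r ^ m * s ^ n = 1 → m = 0 ∧ n = 0)
    (hθ : θ ∈ hopfAut ℂ (BorelG2 r s)) {e : BorelG2 r s} (he0 : e ≠ 0)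
    (he : ∀ m n, ∃ c : ℂˣ, conjLinear (torus r s m n) e = (c : ℂ) • e) :
    ∃ p, θ e ∈ component r s p := by
  obtain ⟨m, n, h⟩ := exists_apply_torus hrs (inv_mem hθ) 1 0
  obtain ⟨c, hc⟩ := he m n
  refine exists_mem_component hrs (x := θ e) (c := c) (by simpa using he0) ?_
  rw [conjLinear_eq_smul_iff] at hc ⊢
  have h1 : θ (torus r s m n) = k₁ r s := by
    rw [← h, torus_one_zero]
    exact θ.apply_symm_apply _
  have h2 := congrArg θ hc
  rwa [map_smul, map_mul, map_mul, h1] at h2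

/-- The map induced on degrees is additive, since `θ` is multiplicative and keeps the torus in
degree 0. -/
theorem apply_mem_component (hrs : ∀ m n : ℤ, r ^ m * s ^ n = 1 → m = 0 ∧ n = 0)
    (hθ : θ ∈ hopfAut ℂ (BorelG2 r s)) {p q d : ℕ × ℕ} (hp : θ (e₁ r s) ∈ component r s p)
    (hq : θ (e₂ r s) ∈ component r s q) :
    ∀ x ∈ component r s d, θ x ∈ component r s (d.1 • p + d.2 • q) := by
  have hle : component r s d ≤ (component r s (d.1 • p + d.2 • q)).comap θ.toLinearMap := by
    refine Submodule.span_le.2 fun y hy => ?_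
    change θ y ∈ component r s _
    induction hy with
    | torus m n =>
      obtain ⟨m', n', h⟩ := exists_apply_torus hrs hθ m n
      rw [h, zero_smul, zero_smul, zero_add]
      exact Submodule.subset_span (.torus m' n')
    | @e₁_mul a b y h ih =>
      rw [map_mul]
      have he : (a + 1) • p + b • q = p + (a • p + b • q) := by
        rw [succ_nsmul', add_assoc]
      exact he ▸ mul_mem_component hrs hp ih
    | @e₂_mul a b y h ih =>
      rw [map_mul]
      have he : a • p + (b + 1) • q = q + (a • p + b • q) := by
        rw [succ_nsmul', add_left_comm]
      exact he ▸ mul_mem_component hrs hq ih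
  exact hle

/-- Two vectors of `ℕ²` that generate `ℕ²` are the unit vectors. -/
theorem eq_unit_vectors_of_generate {p q p' q' : ℕ × ℕ} (h₁ : p'.1 • p + p'.2 • q = (1, 0))
    (h₂ : q'.1 • p + q'.2 • q = (0, 1)) :
    (p = (1, 0) ∧ q = (0, 1)) ∨ (p = (0, 1) ∧ q = (1, 0)) := by
  obtain ⟨a, b⟩ := p
  obtain ⟨c, d⟩ := q
  obtain ⟨x, y⟩ := p'
  obtain ⟨z, w⟩ := q'
  -- Over ℕ a sum is 1 only as 0 + 1 or 1 + 0, and a product is 1 only as 1 · 1, so a finite case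
  -- analysis remains.
  simp only [Prod.smul_mk, smul_eq_mul, Prod.mk_add_mk, Prod.mk.injEq, Nat.add_eq_one_iff,
    Nat.add_eq_zero_iff, mul_eq_zero, mul_eq_one] at *
  grind

/-- A Hopf automorphism preserves or interchanges the degrees of `e₁` and `e₂`. -/
theorem apply_mem_component_or (hrs : ∀ m n : ℤ, r ^ m * s ^ n = 1 → m = 0 ∧ n = 0)
    (hθ : θ ∈ hopfAut ℂ (BorelG2 r s)) :
    (θ (e₁ r s) ∈ component r s (1, 0) ∧ θ (e₂ r s) ∈ component r s (0, 1)) ∨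
      (θ (e₁ r s) ∈ component r s (0, 1) ∧ θ (e₂ r s) ∈ component r s (1, 0)) := by
  obtain ⟨p, hp⟩ := exists_apply_mem_component hrs hθ (e₁_ne_zero r s) exists_conj_torus_e₁
  obtain ⟨q, hq⟩ := exists_apply_mem_component hrs hθ (e₂_ne_zero r s) exists_conj_torus_e₂
  obtain ⟨p', hp'⟩ :=
    exists_apply_mem_component hrs (inv_mem hθ) (e₁_ne_zero r s) exists_conj_torus_e₁
  obtain ⟨q', hq'⟩ :=
    exists_apply_mem_component hrs (inv_mem hθ) (e₂_ne_zero r s) exists_conj_torus_e₂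
  have hinv (x : BorelG2 r s) : θ (θ⁻¹ x) = x := θ.apply_symm_apply x
  -- Applied to θ⁻¹(e₁) of degree `p'`, this gives e₁ the degree p'.1 • p + p'.2 • q, which must be
  -- (1, 0).
  have h₁ := apply_mem_component hrs hθ hp hq _ hp'
  have h₂ := apply_mem_component hrs hθ hp hq _ hq'
  rw [hinv] at h₁ h₂
  rcases eq_unit_vectors_of_generate
    (degree_unique hrs (e₁_ne_zero r s) h₁ (e₁_mem_component r s))
    (degree_unique hrs (e₂_ne_zero r s) h₂ (e₂_mem_component r s)) with ⟨rfl, rfl⟩ | ⟨rfl, rfl⟩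
  · exact .inl ⟨hp, hq⟩
  · exact .inr ⟨hp, hq⟩

theorem comul_apply_e₁ (hθ : θ ∈ hopfAut ℂ (BorelG2 r s)) :
    Coalgebra.comul (R := ℂ) (θ (e₁ r s)) =
      θ (e₁ r s) ⊗ₜ[ℂ] 1 + θ (w₁ r s) ⊗ₜ[ℂ] θ (e₁ r s) := by
  rw [hθ.1, comul_e₁, map_add, TensorProduct.map_tmul, TensorProduct.map_tmul]
  simp only [AlgEquiv.toLinearMap_apply, map_one]
  rfl

theorem comul_apply_e₂ (hθ : θ ∈ hopfAut ℂ (BorelG2 r s)) :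
    Coalgebra.comul (R := ℂ) (θ (e₂ r s)) =
      θ (e₂ r s) ⊗ₜ[ℂ] 1 + θ (w₂ r s) ⊗ₜ[ℂ] θ (e₂ r s) := by
  rw [hθ.1, comul_e₂, map_add, TensorProduct.map_tmul, TensorProduct.map_tmul]
  simp only [AlgEquiv.toLinearMap_apply, map_one]
  rfl

/-- The exponent vectors (2, -1) and (-3, 2) of w₁ and w₂ have determinant 1, so w₁ and w₂ generate
the torus. -/
theorem k₁_eq : k₁ r s = w₁ r s ^ 2 * w₂ r s := by
  rw [← torus_w₁, ← torus_w₂, pow_two, torus_mul, torus_mul, ← torus_one_zero]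
  norm_num

theorem k₂_eq : k₂ r s = w₁ r s ^ 3 * w₂ r s ^ 2 := by
  rw [← torus_w₁, ← torus_w₂, pow_succ, pow_two, pow_two, torus_mul, torus_mul, torus_mul,
    torus_mul, ← torus_zero_one]
  norm_num

theorem apply_generators (hrs : ∀ m n : ℤ, r ^ m * s ^ n = 1 → m = 0 ∧ n = 0)
    (hθ : θ ∈ hopfAut ℂ (BorelG2 r s)) :
    θ (k₁ r s : BorelG2 r s) = k₁ r s ∧ θ (k₂ r s : BorelG2 r s) = k₂ r s ∧
      ∃ γ₁ γ₂ : ℂˣ, θ (e₁ r s) = (γ₁ : ℂ) • e₁ r s ∧ θ (e₂ r s) = (γ₂ : ℂ) • e₂ r s := by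
  have h₁ : θ (e₁ r s) ≠ 0 := by simpa using e₁_ne_zero r s
  have h₂ : θ (e₂ r s) ≠ 0 := by simpa using e₂_ne_zero r s
  rcases apply_mem_component_or hrs hθ with ⟨h, h'⟩ | ⟨h, h'⟩
  · obtain ⟨⟨γ₁, hγ₁⟩, hw₁⟩ := exists_eq_smul_e₁ h h₁ (comul_apply_e₁ hθ)
    obtain ⟨⟨γ₂, hγ₂⟩, hw₂⟩ := exists_eq_smul_e₂ h' h₂ (comul_apply_e₂ hθ)
    refine ⟨?_, ?_, γ₁, γ₂, hγ₁, hγ₂⟩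
    · rw [k₁_eq, Units.val_mul, Units.val_pow_eq_pow_val, map_mul, map_pow, hw₁, hw₂]
    · rw [k₂_eq, Units.val_mul, Units.val_pow_eq_pow_val, Units.val_pow_eq_pow_val, map_mul,
        map_pow, map_pow, hw₁, hw₂]
  -- In the interchanged case θ(e₁) = γe₂ and θ(w₁) = w₂. The image of w₁e₁ = rs⁻¹e₁w₁, compared
  -- with w₂e₂ = r³s⁻³e₂w₂, gives r²s⁻² = 1.
  · exfalso
    obtain ⟨⟨γ, hγ⟩, hw⟩ := exists_eq_smul_e₂ h h₁ (comul_apply_e₁ hθ)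
    have h3 := congrArg θ (sat r s).w₁_e₁
    have h4 : (w₂ r s : BorelG2 r s) * e₂ r s = _ := (sat r s).w₂_e₂
    change θ ((w₁ r s : BorelG2 r s) * e₁ r s) =
      θ (((r : ℂ) * (s : ℂ)⁻¹) • (e₁ r s * (w₁ r s : BorelG2 r s))) at h3
    rw [map_smul, map_mul, map_mul, hw, hγ, mul_smul_comm, smul_mul_assoc, smul_comm _ (γ : ℂ),
      smul_right_inj γ.ne_zero, h4] at h3
    have h5 : e₂ r s * (w₂ r s : BorelG2 r s) ≠ 0 := by
      simpa using e₂_ne_zero r s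
    have h6 := smul_left_injective ℂ h5 h3
    have h7 : r ^ 3 * s⁻¹ ^ 3 = r * s⁻¹ := Units.ext (by simpa using h6)
    have h8 : r ^ (2 : ℤ) * s ^ (-2 : ℤ) = 1 := by
      calc r ^ (2 : ℤ) * s ^ (-2 : ℤ) = (r ^ 3 * s⁻¹ ^ 3) * (r * s⁻¹)⁻¹ := by
            apply Units.ext
            have hr : (r : ℂ) ≠ 0 := r.ne_zero
            have hs : (s : ℂ) ≠ 0 := s.ne_zero
            simp only [zpow_neg, zpow_ofNat, Units.val_mul, Units.val_pow_eq_pow_val,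
              Units.val_inv_eq_inv_val]
            field_simp
        _ = 1 := by rw [h7, mul_inv_cancel]
    exact absurd (hrs _ _ h8).1 (by norm_num)

end HopfAut

/-! ### Rescaling automorphisms -/

section Scale

/-- The Serre relations are bihomogeneous, of degrees (1, 2) and (4, 1) in (e₁, e₂), and the other
relations involving e₁ or e₂ are linear in it. -/
theorem sat_scale (γ : ℂˣ × ℂˣ) : BorelG2Sat r s ((γ.1 : ℂ) • e₁ r s) ((γ.2 : ℂ) • e₂ r s)
    (k₁ r s) (k₂ r s) where
  k₁_k₂ := (sat r s).k₁_k₂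
  k₁_e₁ := by rw [mul_smul_comm, (sat r s).k₁_e₁, smul_mul_assoc, smul_comm]
  k₁_e₂ := by rw [mul_smul_comm, (sat r s).k₁_e₂, smul_mul_assoc, smul_comm]
  k₂_e₁ := by rw [mul_smul_comm, (sat r s).k₂_e₁, smul_mul_assoc, smul_comm]
  k₂_e₂ := by rw [mul_smul_comm, (sat r s).k₂_e₂, smul_mul_assoc, smul_comm]
  serre₂ := by
    have h : serreQuadratic r s ((γ.1 : ℂ) • e₁ r s) ((γ.2 : ℂ) • e₂ r s) =
        ((γ.1 : ℂ) * (γ.2 : ℂ) ^ 2) • serreQuadratic r s (e₁ r s) (e₂ r s) := by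
      simp only [serreQuadratic, smul_pow, mul_smul_comm, smul_mul_assoc, smul_smul, smul_add,
        smul_sub]
      match_scalars <;> ring
    rw [h, (sat r s).serre₂, smul_zero]
  serre₄ := by
    have h : serreQuartic r s ((γ.1 : ℂ) • e₁ r s) ((γ.2 : ℂ) • e₂ r s) =
        ((γ.1 : ℂ) ^ 4 * (γ.2 : ℂ)) • serreQuartic r s (e₁ r s) (e₂ r s) := by
      simp only [serreQuartic, smul_pow, mul_smul_comm, smul_mul_assoc, smul_smul, smul_add,
        smul_sub]
      match_scalars <;> ring
    rw [h, (sat r s).serre₄, smul_zero]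

/-- The endomorphism `eₗ ↦ γₗeₗ`, `kₗ ↦ kₗ`. -/
def scaleHom (r s : ℂˣ) (γ : ℂˣ × ℂˣ) : BorelG2 r s →ₐ[ℂ] BorelG2 r s := lift (sat_scale γ)

theorem scaleHom_e₁ (γ : ℂˣ × ℂˣ) : scaleHom r s γ (e₁ r s) = (γ.1 : ℂ) • e₁ r s := lift_e₁ _

theorem scaleHom_e₂ (γ : ℂˣ × ℂˣ) : scaleHom r s γ (e₂ r s) = (γ.2 : ℂ) • e₂ r s := lift_e₂ _

theorem scaleHom_k₁ (γ : ℂˣ × ℂˣ) : scaleHom r s γ (k₁ r s : BorelG2 r s) = k₁ r s := lift_k₁ _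

theorem scaleHom_k₂ (γ : ℂˣ × ℂˣ) : scaleHom r s γ (k₂ r s : BorelG2 r s) = k₂ r s := lift_k₂ _

theorem scaleHom_w₁ (γ : ℂˣ × ℂˣ) : scaleHom r s γ (w₁ r s : BorelG2 r s) = w₁ r s := lift_w₁ _

theorem scaleHom_w₂ (γ : ℂˣ × ℂˣ) : scaleHom r s γ (w₂ r s : BorelG2 r s) = w₂ r s := lift_w₂ _

theorem scaleHom_mul (γ δ : ℂˣ × ℂˣ) :
    scaleHom r s (γ * δ) = (scaleHom r s γ).comp (scaleHom r s δ) := by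
  apply hom_ext <;>
  simp [scaleHom_e₁, scaleHom_e₂, scaleHom_k₁, scaleHom_k₂, smul_smul, mul_comm]

theorem scaleHom_one : scaleHom r s 1 = AlgHom.id ℂ (BorelG2 r s) := by
  apply hom_ext <;> simp [scaleHom_e₁, scaleHom_e₂, scaleHom_k₁, scaleHom_k₂]

/-- The automorphism `eₗ ↦ γₗeₗ`, `kₗ ↦ kₗ`. -/
def scaleEquiv (r s : ℂˣ) (γ : ℂˣ × ℂˣ) : BorelG2 r s ≃ₐ[ℂ] BorelG2 r s :=
  AlgEquiv.ofAlgHom (scaleHom r s γ) (scaleHom r s γ⁻¹)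
    (by rw [← scaleHom_mul, mul_inv_cancel, scaleHom_one])
    (by rw [← scaleHom_mul, inv_mul_cancel, scaleHom_one])

theorem comulHom_comp_scaleHom (γ : ℂˣ × ℂˣ) : (comulHom r s).comp (scaleHom r s γ) =
    (Algebra.TensorProduct.map (scaleHom r s γ) (scaleHom r s γ)).comp (comulHom r s) := by
  apply hom_ext <;>
  simp [scaleHom_e₁, scaleHom_e₂, scaleHom_k₁, scaleHom_k₂, comulHom_e₁, comulHom_e₂,
    comulHom_k₁, comulHom_k₂, scaleHom_w₁, scaleHom_w₂, TensorProduct.smul_tmul']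

theorem counitHom_comp_scaleHom (γ : ℂˣ × ℂˣ) :
    (counitHom r s).comp (scaleHom r s γ) = counitHom r s := by
  apply hom_ext <;>
  simp [scaleHom_e₁, scaleHom_e₂, scaleHom_k₁, scaleHom_k₂, counitHom_e₁, counitHom_e₂]

theorem scaleHom_unit_inv (γ : ℂˣ × ℂˣ) {u : (BorelG2 r s)ˣ} (h : scaleHom r s γ u = u) :
    scaleHom r s γ (u⁻¹ : (BorelG2 r s)ˣ) = (u⁻¹ : (BorelG2 r s)ˣ) := by
  have h1 : Units.map (scaleHom r s γ : BorelG2 r s →* BorelG2 r s) u = u := Units.ext h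
  exact congrArg (fun v : (BorelG2 r s)ˣ => ((v⁻¹ : (BorelG2 r s)ˣ) : BorelG2 r s)) h1

/-- Both composites are algebra homomorphisms into the opposite algebra, so agreement on the
generators suffices. -/
theorem antipodeHom_comp_scaleHom (γ : ℂˣ × ℂˣ) : (antipodeHom r s).comp (scaleHom r s γ) =
    (AlgHom.op (scaleHom r s γ)).comp (antipodeHom r s) := by
  apply hom_ext
  all_goals apply MulOpposite.unop_injective
  · change antipodeMap r s (scaleHom r s γ _) = scaleHom r s γ (antipodeMap r s _)
    rw [scaleHom_e₁, map_smul, antipodeMap_e₁, map_neg, map_mul, scaleHom_e₁,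
      scaleHom_unit_inv γ (scaleHom_w₁ γ), mul_smul_comm, smul_neg]
  · change antipodeMap r s (scaleHom r s γ _) = scaleHom r s γ (antipodeMap r s _)
    rw [scaleHom_e₂, map_smul, antipodeMap_e₂, map_neg, map_mul, scaleHom_e₂,
      scaleHom_unit_inv γ (scaleHom_w₂ γ), mul_smul_comm, smul_neg]
  · change antipodeMap r s (scaleHom r s γ _) = scaleHom r s γ (antipodeMap r s _)
    rw [scaleHom_k₁, antipodeMap_k₁, scaleHom_unit_inv γ (scaleHom_k₁ γ)]
  · change antipodeMap r s (scaleHom r s γ _) = scaleHom r s γ (antipodeMap r s _)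
    rw [scaleHom_k₂, antipodeMap_k₂, scaleHom_unit_inv γ (scaleHom_k₂ γ)]

theorem scaleEquiv_mem_hopfAut (γ : ℂˣ × ℂˣ) : scaleEquiv r s γ ∈ hopfAut ℂ (BorelG2 r s) :=
  ⟨fun x => DFunLike.congr_fun (comulHom_comp_scaleHom γ) x,
    fun x => DFunLike.congr_fun (counitHom_comp_scaleHom γ) x,
    fun x => congrArg MulOpposite.unop (DFunLike.congr_fun (antipodeHom_comp_scaleHom γ) x)⟩

/-- The action of the torus `(ℂˣ)²` by Hopf automorphisms. -/
def scaleAut (r s : ℂˣ) : ℂˣ × ℂˣ →* hopfAut ℂ (BorelG2 r s) where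
  toFun γ := ⟨scaleEquiv r s γ, scaleEquiv_mem_hopfAut γ⟩
  map_one' := Subtype.ext (AlgEquiv.ext fun x => DFunLike.congr_fun scaleHom_one x)
  map_mul' γ δ := Subtype.ext (AlgEquiv.ext fun x => DFunLike.congr_fun (scaleHom_mul γ δ) x)

theorem scaleAut_apply (γ : ℂˣ × ℂˣ) (x : BorelG2 r s) :
    (scaleAut r s γ : BorelG2 r s ≃ₐ[ℂ] BorelG2 r s) x = scaleHom r s γ x := rfl

/-- Injectivity reads the scalars off the nonzero `e₁` and `e₂`; surjectivity is `apply_generators`,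
as an automorphism is determined by its values on the generators. -/
theorem scaleAut_bijective (hrs : ∀ m n : ℤ, r ^ m * s ^ n = 1 → m = 0 ∧ n = 0) :
    Function.Bijective (scaleAut r s) := by
  constructor
  · intro γ δ h
    have h1 (x : BorelG2 r s) : scaleHom r s γ x = scaleHom r s δ x := by
      rw [← scaleAut_apply, h, scaleAut_apply]
    have h2 := h1 (e₁ r s)
    have h3 := h1 (e₂ r s)
    rw [scaleHom_e₁, scaleHom_e₁] at h2
    rw [scaleHom_e₂, scaleHom_e₂] at h3
    exact Prod.ext (Units.ext (smul_left_injective ℂ (e₁_ne_zero r s) h2))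
      (Units.ext (smul_left_injective ℂ (e₂_ne_zero r s) h3))
  · rintro ⟨θ, hθ⟩
    obtain ⟨h1, h2, γ₁, γ₂, h3, h4⟩ := apply_generators hrs hθ
    refine ⟨(γ₁, γ₂), Subtype.ext (AlgEquiv.ext fun x => ?_)⟩
    have h : scaleHom r s (γ₁, γ₂) = (θ : BorelG2 r s →ₐ[ℂ] BorelG2 r s) := by
      apply hom_ext <;>
      simp [scaleHom_e₁, scaleHom_e₂, scaleHom_k₁, scaleHom_k₂, h1, h2, h3, h4]
    exact DFunLike.congr_fun h x

end Scale

end BorelG2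

end

/-! ### The theorem -/

theorem theorem3p1 (r s : ℂˣ)
    (hrs : ∀ m n : ℤ, r ^ m * s ^ n = 1 → m = 0 ∧ n = 0) :
    (∀ θ ∈ hopfAut ℂ (BorelG2 r s),
      θ (BorelG2.k₁ r s : BorelG2 r s) = BorelG2.k₁ r s ∧
      θ (BorelG2.k₂ r s : BorelG2 r s) = BorelG2.k₂ r s ∧
      ∃ γ₁ γ₂ : ℂˣ, θ (BorelG2.e₁ r s) = (γ₁ : ℂ) • BorelG2.e₁ r s ∧
        θ (BorelG2.e₂ r s) = (γ₂ : ℂ) • BorelG2.e₂ r s) ∧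
    ∃ Φ : hopfAut ℂ (BorelG2 r s) ≃* ℂˣ × ℂˣ, ∀ θ : hopfAut ℂ (BorelG2 r s),
      (θ : BorelG2 r s ≃ₐ[ℂ] BorelG2 r s) (BorelG2.e₁ r s) =
        ((Φ θ).1 : ℂ) • BorelG2.e₁ r s ∧
      (θ : BorelG2 r s ≃ₐ[ℂ] BorelG2 r s) (BorelG2.e₂ r s) =
        ((Φ θ).2 : ℂ) • BorelG2.e₂ r s := by
  refine ⟨fun θ hθ => BorelG2.apply_generators hrs hθ,
    (MulEquiv.ofBijective (BorelG2.scaleAut r s) (BorelG2.scaleAut_bijective hrs)).symm,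
    fun θ => ?_⟩
  obtain ⟨γ, rfl⟩ := (BorelG2.scaleAut_bijective hrs).2 θ
  have h : (MulEquiv.ofBijective (BorelG2.scaleAut r s)
      (BorelG2.scaleAut_bijective hrs)).symm (BorelG2.scaleAut r s γ) = γ :=
    MulEquiv.symm_apply_apply _ γ
  rw [h, BorelG2.scaleAut_apply, BorelG2.scaleAut_apply, BorelG2.scaleHom_e₁, BorelG2.scaleHom_e₂]
  exact ⟨rfl, rfl⟩
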